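/- Let $n,p,m,T,N\ge 1$ be integers and consider the linear system $x_0=0$, $x_{t+1}=Ax_t+Bu_t+w_t$, $y_t=Cx_t+Du_t+v_t$ with $x_t\in\mathbb R^n$, $u_t\in\mathbb R^p$, $y_t\in\mathbb R^m$. For a matrix $M$ with rows $M_{i:}$ write $\|M\|_{q,\infty}=\max_i\|M_{i:}\|_q$, $\|M\|_{1,1}=\sum_{i,j}|M_{ij}|$, and $\|M\|_F$ for the Frobenius norm. Let $C_{\mathrm{sys}}\ge 1$ and $0\le\rho<1$ satisfy $\|A^\tau\|_{1,\infty}\le C_{\mathrm{sys}}\rho^\tau$ for all integers $\tau\ge 0$ and $\max\{\|B\|_{1,\infty},\|C\|_{1,\infty},\|D\|_{1,\infty}\}\le C_{\mathrm{sys}}$. All entries of $u_t,w_t,v_t$, $0\le t\le T+N-2$, are independent random variables; $u_t\sim\mathcal N(0,\sigma_u^2 I)$ with $0<\sigma_u\le 2$, and the entries of $w_t$ and of $v_t$ are sub-Gaussian with parameters $\sigma_w\ge0$ and $\sigma_v\ge0$ respectively (that is, $\mathbb E\,e^{sX}\le e^{\sigma^2s^2/2}$ for all $s\in\mathbb R$).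 Put $$G=\begin{bmatrix}D& CB& CAB&\cdots& CA^{T-2}B\end{bmatrix}\in\mathbb R^{m\times Tp},\qquad \bar u_t=\begin{bmatrix}u_t^\top&u_{t-1}^\top&\cdots&u_{t-T+1}^\top\end{bmatrix}^\top\in\mathbb R^{Tp},\qquad \bar\sigma_w=\frac{C_{\mathrm{sys}}^2}{1-\rho}\,\sigma_w,$$ and let $\widehat G$ be any minimizer over $X\in\mathbb R^{m\times Tp}$ of $$\frac1{2N}\sum_{t=T-1}^{N+T-2}\|y_t-X\bar u_t\|_2^2+\lambda\|X\|_{1,1}.$$ For $\varepsilon>0$ define $$T_0=\frac{\log\log(Nn+Tp)+\log\frac{C_{\mathrm{sys}}}{1-\rho}+\log\max\{1,\frac{\sigma_w+\sigma_u}{\varepsilon}\}}{1-\rho},\qquad \Lambda=\sigma_u(\bar\sigma_w+\sigma_v)\sqrt{\frac{\log(Tpn)}{N}}+\varepsilon,$$ $$\mathcal E_1=\sqrt{\frac{C_{\mathrm{sys}}^3}{1-\rho}}\left(\sqrt{\frac{\bar\sigma_w+\sigma_v}{\sigma_u^3}}\Big(\frac{\log(Tpn)}{N}\Big)^{1/4}+\frac{\sqrt{\varepsilon}}{\sigma_u^2}\right),\qquad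 \mathcal E_2=\frac{C_{\mathrm{sys}}^3}{1-\rho}\Big(\frac{\log(Tp)}{N}\Big)^{1/4}.$$ For every $\eta>0$ there are constants $K,c_1>0$ depending only on $\eta$, and for every $c_2\ge c_1$ a constant $c_3>0$ depending only on $\eta$ and $c_2$, such that the following holds for all systems, dimensions, noise levels and $\varepsilon>0$ as above. If $N\ge K\log^2(Tp)$, $T\ge K\,T_0$ and $c_1\Lambda\le\lambda\le c_2\Lambda$, then, outside an event of probability at most $m\,(Tp)^{-\eta}$, $$\|G-\widehat G\|_{2,\infty}\le c_3\max\{\mathcal E_1,\mathcal E_2\}\qquad\text{and}\qquad \|G-\widehat G\|_F\le c_3\sqrt m\,\max\{\mathcal E_1,\mathcal E_2\}.$$ -/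

import Mathlib

open MeasureTheory ProbabilityTheory
open scoped NNReal ENNReal Matrix

noncomputable section

namespace LTI

variable {n p m : ℕ}

/-- The state trajectory `x₀ = 0`, `x_{t+1} = A x_t + B u_t + w_t`. -/
def state (A : Matrix (Fin n) (Fin n) ℝ) (B : Matrix (Fin n) (Fin p) ℝ)
    (u : ℕ → Fin p → ℝ) (w : ℕ → Fin n → ℝ) : ℕ → Fin n → ℝ
  | 0 => 0
  | t + 1 => A *ᵥ state A B u w t + B *ᵥ u t + w t

/-- The output `y_t = C x_t + D u_t + v_t`. -/
def output (A : Matrix (Fin n) (Fin n) ℝ) (B : Matrix (Fin n) (Fin p) ℝ)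
    (C : Matrix (Fin m) (Fin n) ℝ) (D : Matrix (Fin m) (Fin p) ℝ)
    (u : ℕ → Fin p → ℝ) (w : ℕ → Fin n → ℝ) (v : ℕ → Fin m → ℝ) (t : ℕ) : Fin m → ℝ :=
  C *ᵥ state A B u w t + D *ᵥ u t + v t

/-- The Markov matrix `G = [D, CB, CAB, …, CA^{T-2}B]`. Its `T * p` columns are indexed by
`Fin T × Fin p`: the pair `(k, j)` is the `j`-th column of the `k`-th block. -/
def markovMatrix (A : Matrix (Fin n) (Fin n) ℝ) (B : Matrix (Fin n) (Fin p) ℝ)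
    (C : Matrix (Fin m) (Fin n) ℝ) (D : Matrix (Fin m) (Fin p) ℝ) (T : ℕ) :
    Matrix (Fin m) (Fin T × Fin p) ℝ :=
  fun i kj => if (kj.1 : ℕ) = 0 then D i kj.2 else (C * A ^ ((kj.1 : ℕ) - 1) * B) i kj.2

/-- The concatenated input `ū_t = (u_t, u_{t-1}, …, u_{t-T+1})`, used for `t ≥ T - 1` only. -/
def stackedInput (T : ℕ) (u : ℕ → Fin p → ℝ) (t : ℕ) : Fin T × Fin p → ℝ :=
  fun kj => u (t - (kj.1 : ℕ)) kj.2

/-- The objective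
`(1 / 2N) ∑_{t = T-1}^{N+T-2} ‖y_t - X ū_t‖₂² + λ ‖X‖_{1,1}`. -/
def lassoObjective (T N : ℕ) (lam : ℝ) (u : ℕ → Fin p → ℝ) (y : ℕ → Fin m → ℝ)
    (X : Matrix (Fin m) (Fin T × Fin p) ℝ) : ℝ :=
  1 / (2 * (N : ℝ)) *
      ∑ t ∈ Finset.Ico (T - 1) (T - 1 + N), ∑ i, (y t i - (X *ᵥ stackedInput T u t) i) ^ 2
    + lam * ∑ i, ∑ kj, |X i kj|

/-- `X` is an `ℓ₁`-regularized estimate: a global minimizer of the objective. -/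
def IsLassoEstimate (T N : ℕ) (lam : ℝ) (u : ℕ → Fin p → ℝ) (y : ℕ → Fin m → ℝ)
    (X : Matrix (Fin m) (Fin T × Fin p) ℝ) : Prop :=
  ∀ Z : Matrix (Fin m) (Fin T × Fin p) ℝ,
    lassoObjective T N lam u y X ≤ lassoObjective T N lam u y Z

/-- The largest `ℓ₁`-norm of a row. -/
def rowL1Norm {ι κ : Type*} [Fintype κ] (M : Matrix ι κ ℝ) : ℝ :=
  ⨆ i, ∑ j, |M i j|

/-- `‖M‖_{2,∞}`: the largest `ℓ₂`-norm of a row. -/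
def twoInfNorm {ι κ : Type*} [Fintype κ] (M : Matrix ι κ ℝ) : ℝ :=
  ⨆ i, √(∑ j, M i j ^ 2)

/-- The Frobenius norm. -/
def frobNorm {ι κ : Type*} [Fintype ι] [Fintype κ] (M : Matrix ι κ ℝ) : ℝ :=
  √(∑ i, ∑ j, M i j ^ 2)

/-- All scalar sources of randomness at time `t`: the entries of `u_t`, `w_t` and `v_t`. -/
def source {Ω : Type*} (u : ℕ → Ω → Fin p → ℝ) (w : ℕ → Ω → Fin n → ℝ)
    (v : ℕ → Ω → Fin m → ℝ) (t : ℕ) : Fin p ⊕ Fin n ⊕ Fin m → Ω → ℝ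
  | .inl j => fun ω => u t ω j
  | .inr (.inl j) => fun ω => w t ω j
  | .inr (.inr j) => fun ω => v t ω j

/-- The effective variance `σ̄_w = C_sys² / (1 - ρ) * σ_w` of the disturbance. -/
def effSigma (Csys ρ σw : ℝ) : ℝ :=
  Csys ^ 2 / (1 - ρ) * σw

/-- The threshold `T₀` for the length of the regressor. -/
def horizonThreshold (n p T N : ℕ) (Csys ρ σu σw ε : ℝ) : ℝ :=
  (Real.log (Real.log ((N : ℝ) * n + (T : ℝ) * p)) + Real.log (Csys / (1 - ρ))
    + Real.log (max 1 ((σw + σu) / ε))) / (1 - ρ)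

/-- The scale `σ_u (σ̄_w + σ_v) √(log(Tpn) / N) + ε` of the regularization parameter. -/
def lambdaScale (n p T N : ℕ) (Csys ρ σu σw σv ε : ℝ) : ℝ :=
  σu * (effSigma Csys ρ σw + σv) * √(Real.log ((T : ℝ) * p * n) / N) + ε

/-- The error term `𝓔₁`. -/
def errOne (n p T N : ℕ) (Csys ρ σu σw σv ε : ℝ) : ℝ :=
  √(Csys ^ 3 / (1 - ρ)) *
    (√((effSigma Csys ρ σw + σv) / σu ^ 3) *
        (Real.log ((T : ℝ) * p * n) / N) ^ ((1 : ℝ) / 4)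
      + √ε / σu ^ 2)

/-- The error term `𝓔₂`. -/
def errTwo (p T N : ℕ) (Csys ρ : ℝ) : ℝ :=
  Csys ^ 3 / (1 - ρ) * (Real.log ((T : ℝ) * p) / N) ^ ((1 : ℝ) / 4)

end LTI

end

/-!
# Learning the Markov matrix of a stable linear system by `ℓ₁`-regularized least squares

The error bounds are the slow rate of the lasso, and no restricted eigenvalue condition is needed:
stability makes every row of the Markov matrix `G` small in `ℓ₁`, namely `‖G i‖₁ ≤ R` with
`R = 2 Csys³ / (1 - ρ)` (`LTI.sum_abs_markovMatrix_le`).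

The objective separates over the rows (`LTI.IsLassoEstimate.row`). If `λ / 2` dominates the
empirical correlations between the regressors and the noise of row `i`, minimality gives
`‖Ĝ i‖₁ ≤ 3 R` and a prediction error of at most `3 λ R`. If moreover the empirical second moments
of the regressors differ from `σu² I` by at most `δ σu²` in every entry, the prediction error is at
least `σu² (‖Δ‖₂² - δ ‖Δ‖₁²)` for the error `Δ`, whence `‖Δ‖₂² ≤ 3 λ R / σu² + 16 R² δ`
(`LTI.sum_sq_sub_le_of_lasso`). With `δ` of order `√(log (T p) / N)` and `λ` of the prescribed size
these two terms are of the order of the squares of the two error terms of the theorem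
(`LTI.lasso_error_le`).

Both requirements concern sums over time of products of two entries, at fixed lags, of an
independent array. For different entries such a sum splits into two sums of independent products of
a Gaussian and a sub-Gaussian variable, and hence has sub-exponential moments
(`LTI.hasSubexpMGF_sum_lag_mul`); the squares on the diagonal are treated in the same way. The noise
of the regression is a weighted sum of lagged sources: old inputs, process noise and observation
noise (`LTI.output_eq_markovMatrix_mulVec_add`). Jensen's inequality (`LTI.HasSubexpMGF.sum`)
therefore carries the moment bound over to the correlations, with a scale given by the weighted
`ℓ₁`-norm of the coefficients. Stability bounds that norm by the effective variance `σ̄_w + σ_v`,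
apart from the contribution of the inputs older than `T` steps, which the condition on the horizon
makes smaller than `ε` (`LTI.truncation_le`). A union bound over the entries concludes.
-/

namespace LTI

/-! ### Exponential moments of products of two random variables -/

section Moments

variable {Ω : Type*} [MeasurableSpace Ω] {μ : Measure Ω}

lemma neg_log_one_sub_le {x : ℝ} (hx : |x| ≤ 1 / 2) : -Real.log (1 - x) ≤ x + 2 * x ^ 2 := by
  have h := Real.abs_log_sub_add_sum_range_le (show |x| < 1 by linarith) 1
  simp only [Finset.sum_range_one, zero_add, pow_one, Nat.cast_zero, div_one, sq_abs,
    Nat.reduceAdd] at h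
  have h2 : x ^ 2 / (1 - |x|) ≤ 2 * x ^ 2 := by
    rw [div_le_iff₀ (by linarith)]
    nlinarith [sq_nonneg x]
  have := (abs_le.1 (h.trans h2)).1
  linarith

/-- The moment generating function of the square of a centred Gaussian variable. -/
lemma lintegral_exp_mul_sq_gaussianReal {v : ℝ≥0} (hv : v ≠ 0) {a : ℝ} (ha : 2 * a * v < 1) :
    ∫⁻ x, ENNReal.ofReal (Real.exp (a * x ^ 2)) ∂gaussianReal 0 v
      = ENNReal.ofReal (Real.exp (-Real.log (1 - 2 * a * v) / 2)) := by
  have hv' : (0 : ℝ) < v := by positivity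
  have h1 : 0 < 1 - 2 * a * v := by linarith
  set b : ℝ := (1 - 2 * a * v) / (2 * v) with hb
  have hb0 : 0 < b := by positivity
  have key : ∀ x : ℝ, gaussianPDF 0 v x * ENNReal.ofReal (Real.exp (a * x ^ 2))
      = ENNReal.ofReal ((√(2 * Real.pi * v))⁻¹ * Real.exp (-b * x ^ 2)) := by
    intro x
    rw [gaussianPDF, gaussianPDFReal, ← ENNReal.ofReal_mul (by positivity), mul_assoc,
      ← Real.exp_add]
    congr 3
    rw [hb]
    field_simp
    ring
  rw [gaussianReal_of_var_ne_zero _ hv, lintegral_withDensity_eq_lintegral_mul _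
    (measurable_gaussianPDF 0 v) (by fun_prop)]
  simp only [Pi.mul_apply, key]
  rw [← ofReal_integral_eq_lintegral_ofReal ((integrable_exp_neg_mul_sq hb0).const_mul _)
    (Filter.Eventually.of_forall fun x => by positivity), integral_const_mul, integral_gaussian]
  congr 1
  rw [show -Real.log (1 - 2 * a * v) / 2 = -(Real.log (1 - 2 * a * v) / 2) by ring, Real.exp_neg,
    ← Real.log_sqrt h1.le, Real.exp_log (Real.sqrt_pos.2 h1), ← Real.sqrt_inv, ← Real.sqrt_inv,
    ← Real.sqrt_mul (by positivity)]
  congr 1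
  rw [hb]
  field_simp

lemma lintegral_exp_mul_le {Y : Ω → ℝ} {c : ℝ≥0} (h : HasSubgaussianMGF Y c μ) (t : ℝ) :
    ∫⁻ ω, ENNReal.ofReal (Real.exp (t * Y ω)) ∂μ
      ≤ ENNReal.ofReal (Real.exp (c * t ^ 2 / 2)) := by
  rw [← ofReal_integral_eq_lintegral_ofReal (h.integrable_exp_mul t)
    (Filter.Eventually.of_forall fun x => by positivity)]
  exact ENNReal.ofReal_le_ofReal (h.mgf_le t)

/-- Integrating out the sub-Gaussian factor first leaves the exponential moment of the square of
the Gaussian one. -/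
lemma lintegral_exp_mul_mul_le [IsProbabilityMeasure μ] {X Y : Ω → ℝ} {v c : ℝ≥0} (hv : v ≠ 0)
    (hX : Measurable X) (hY : Measurable Y) (hXY : IndepFun X Y μ)
    (hXl : HasLaw X (gaussianReal 0 v) μ) (hYs : HasSubgaussianMGF Y c μ) {s : ℝ}
    (hs : 2 * (s ^ 2 * v * c) ≤ 1) :
    ∫⁻ ω, ENNReal.ofReal (Real.exp (s * (X ω * Y ω))) ∂μ
      ≤ ENNReal.ofReal (Real.exp (s ^ 2 * v * c)) := by
  have h1 : ∫⁻ ω, ENNReal.ofReal (Real.exp (s * (X ω * Y ω))) ∂μ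
      = ∫⁻ z, ENNReal.ofReal (Real.exp (s * (z.1 * z.2))) ∂((μ.map X).prod (μ.map Y)) := by
    rw [← (indepFun_iff_map_prod_eq_prod_map_map hX.aemeasurable hY.aemeasurable).1 hXY,
      lintegral_map (by fun_prop) (hX.prodMk hY)]
  have : IsProbabilityMeasure (μ.map Y) := Measure.isProbabilityMeasure_map hY.aemeasurable
  rw [h1, lintegral_prod _ (by fun_prop), hXl.map_eq]
  calc ∫⁻ x, ∫⁻ y, ENNReal.ofReal (Real.exp (s * (x * y))) ∂(μ.map Y) ∂gaussianReal 0 v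
      ≤ ∫⁻ x, ENNReal.ofReal (Real.exp ((c * s ^ 2 / 2) * x ^ 2)) ∂gaussianReal 0 v := by
        refine lintegral_mono fun x => ?_
        rw [lintegral_map (by fun_prop) hY]
        have := lintegral_exp_mul_le hYs (s * x)
        simp only [mul_assoc] at this ⊢
        refine this.trans_eq ?_
        congr 2
        ring
    _ = ENNReal.ofReal (Real.exp (-Real.log (1 - 2 * (c * s ^ 2 / 2) * v) / 2)) :=
        lintegral_exp_mul_sq_gaussianReal hv (by nlinarith)
    _ ≤ _ := by
        refine ENNReal.ofReal_le_ofReal (Real.exp_le_exp.2 ?_)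
        have h0 : 0 ≤ s ^ 2 * v * c := by positivity
        have h := neg_log_one_sub_le (x := s ^ 2 * v * c) (by rw [abs_of_nonneg h0]; linarith)
        rw [show 2 * (c * s ^ 2 / 2) * v = s ^ 2 * v * c by ring]
        nlinarith

/-- The centred square of a Gaussian variable. -/
lemma lintegral_exp_mul_sq_sub_le [IsProbabilityMeasure μ] {X : Ω → ℝ} {v : ℝ≥0} (hv : v ≠ 0)
    (hXl : HasLaw X (gaussianReal 0 v) μ) {s : ℝ} (hs : |s| * v ≤ 1 / 4) :
    ∫⁻ ω, ENNReal.ofReal (Real.exp (s * (X ω * X ω - v))) ∂μ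
      ≤ ENNReal.ofReal (Real.exp (4 * s ^ 2 * (v * v))) := by
  have hx : |2 * s * v| ≤ 1 / 2 := by
    rw [abs_mul, abs_mul, abs_two, abs_of_nonneg (NNReal.coe_nonneg v)]; linarith
  have h0 := lintegral_exp_mul_sq_gaussianReal hv (a := s) (by linarith [(abs_le.1 hx).2])
  rw [← hXl.map_eq, lintegral_map' (by fun_prop) hXl.aemeasurable] at h0
  have h1 : ∀ ω, ENNReal.ofReal (Real.exp (s * (X ω * X ω - v)))
      = ENNReal.ofReal (Real.exp (-s * v)) * ENNReal.ofReal (Real.exp (s * X ω ^ 2)) := by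
    intro ω
    rw [← ENNReal.ofReal_mul (by positivity), ← Real.exp_add]
    congr 2
    ring
  simp only [h1]
  rw [lintegral_const_mul' _ _ ENNReal.ofReal_ne_top, h0, ← ENNReal.ofReal_mul (by positivity),
    ← Real.exp_add]
  refine ENNReal.ofReal_le_ofReal (Real.exp_le_exp.2 ?_)
  nlinarith [neg_log_one_sub_le hx]

/-- Functions of disjoint pairs of members of an independent family factorize in expectation. -/
lemma lintegral_prod_pairs {ι κ : Type*} [DecidableEq ι] [IsProbabilityMeasure μ]
    {X : ι → Ω → ℝ} (hX : ∀ i, Measurable (X i)) (hind : iIndepFun X μ)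
    (f g : κ → ι) (hf : f.Injective) (hg : g.Injective) (hfg : ∀ a b, a ≠ b → f a ≠ g b)
    (φ : ℝ → ℝ → ℝ≥0∞) (hφ : Measurable fun z : ℝ × ℝ => φ z.1 z.2) (S : Finset κ) :
    ∫⁻ ω, ∏ t ∈ S, φ (X (f t) ω) (X (g t) ω) ∂μ
      = ∏ t ∈ S, ∫⁻ ω, φ (X (f t) ω) (X (g t) ω) ∂μ := by
  classical
  induction S using Finset.cons_induction with
  | empty => simp
  | cons a S ha ih =>
    simp only [Finset.prod_cons]
    rw [← ih]
    have hdisj : Disjoint ({f a, g a} : Finset ι) (S.image f ∪ S.image g) := by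
      rw [Finset.disjoint_left]
      intro x hx hx'
      simp only [Finset.mem_insert, Finset.mem_singleton, Finset.mem_union,
        Finset.mem_image] at hx hx'
      rcases hx' with ⟨b, hb, rfl⟩ | ⟨b, hb, rfl⟩ <;>
        have hab : a ≠ b := (fun h => ha (h ▸ hb)) <;> rcases hx with h | h
      · exact hab (hf h.symm)
      · exact hfg b a hab.symm h
      · exact hfg a b hab h.symm
      · exact hab (hg h.symm)
    have hI := hind.indepFun_finset _ _ hdisj hX
    have hφ' : Measurable fun z : (({f a, g a} : Finset ι) → ℝ) =>
        φ (z ⟨f a, by simp⟩) (z ⟨g a, by simp⟩) := by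
      exact hφ.comp (f := fun z : (({f a, g a} : Finset ι) → ℝ) =>
        (z ⟨f a, by simp⟩, z ⟨g a, by simp⟩)) (by fun_prop)
    have hψ' : Measurable fun z : ((S.image f ∪ S.image g : Finset ι) → ℝ) =>
        ∏ t ∈ S.attach, φ (z ⟨f t, Finset.mem_union_left _ (Finset.mem_image_of_mem f t.2)⟩)
          (z ⟨g t, Finset.mem_union_right _ (Finset.mem_image_of_mem g t.2)⟩) := by
      refine Finset.measurable_prod _ fun t _ => ?_
      exact hφ.comp (f := fun z : ((S.image f ∪ S.image g : Finset ι) → ℝ) =>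
        (z ⟨f t, Finset.mem_union_left _ (Finset.mem_image_of_mem f t.2)⟩,
          z ⟨g t, Finset.mem_union_right _ (Finset.mem_image_of_mem g t.2)⟩)) (by fun_prop)
    have hI' := hI.comp hφ' hψ'
    have := lintegral_mul_eq_lintegral_mul_lintegral_of_indepFun''
      (hφ'.comp (measurable_pi_lambda _ fun i => hX i)).aemeasurable
      (hψ'.comp (measurable_pi_lambda _ fun i => hX i)).aemeasurable hI'
    simp only [Function.comp_def] at this
    have hatt : ∀ ω, ∏ t ∈ S.attach, φ (X (f t) ω) (X (g t) ω)
        = ∏ t ∈ S, φ (X (f t) ω) (X (g t) ω) := fun ω =>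
      Finset.prod_attach S fun t => φ (X (f t) ω) (X (g t) ω)
    simpa only [hatt] using this

/-! ### Sub-exponential variables -/

/-- `Z` has the exponential moments of a sum of `N` independent centred sub-exponential variables
of scale `τ`: the Gaussian bound `exp (4 s² τ² N)` in the range `|s| τ ≤ 1 / 4`. -/
def HasSubexpMGF (Z : Ω → ℝ) (τ N : ℝ) (μ : Measure Ω) : Prop :=
  ∀ s : ℝ, |s| * τ ≤ 1 / 4 →
    ∫⁻ ω, ENNReal.ofReal (Real.exp (s * Z ω)) ∂μ ≤ ENNReal.ofReal (Real.exp (4 * s ^ 2 * τ ^ 2 * N))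

lemma HasSubexpMGF.neg {Z : Ω → ℝ} {τ N : ℝ} (h : HasSubexpMGF Z τ N μ) :
    HasSubexpMGF (fun ω => -Z ω) τ N μ := by
  intro s hs
  simpa using h (-s) (by simpa using hs)

/-- Chernoff's bound with `s = √(L / N) / τ`, which lies in the admissible range as
`16 L ≤ N`. -/
lemma HasSubexpMGF.measure_lt_abs_le {Z : Ω → ℝ} {τ N L : ℝ} (h : HasSubexpMGF Z τ N μ)
    (hZ : AEMeasurable Z μ) (hτ : 0 < τ) (hL : 0 ≤ L) (hN : 0 < N) (hLN : 16 * L ≤ N) (c : ℝ) :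
    μ {ω | c * τ * √(L / N) * N < |Z ω|} ≤ ENNReal.ofReal (2 * Real.exp (-((c - 4) * L))) := by
  set r := √(L / N) with hr
  have hr0 : 0 ≤ r := Real.sqrt_nonneg _
  have hrsq : r ^ 2 * N = L := by rw [hr, Real.sq_sqrt (by positivity)]; field_simp
  have hr4 : r ≤ 1 / 4 := by
    rw [hr]
    refine Real.sqrt_le_iff.2 ⟨by norm_num, ?_⟩
    rw [div_le_iff₀ hN]; linarith
  have key : ∀ W : Ω → ℝ, HasSubexpMGF W τ N μ → AEMeasurable W μ →
      μ {ω | c * τ * r * N < W ω} ≤ ENNReal.ofReal (Real.exp (-((c - 4) * L))) := by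
    intro W hW hWm
    have h1 := hW (r / τ) (by rw [abs_of_nonneg (by positivity)]; field_simp; linarith)
    have h2 : μ {ω | c * τ * r * N < W ω} ≤ μ {ω | ENNReal.ofReal (Real.exp (c * L))
        ≤ ENNReal.ofReal (Real.exp (r / τ * W ω))} := by
      refine measure_mono fun ω hω => ENNReal.ofReal_le_ofReal (Real.exp_le_exp.2 ?_)
      have hω' : c * τ * r * N < W ω := hω
      calc c * L = r / τ * (c * τ * r * N) := by rw [← hrsq]; field_simp
        _ ≤ _ := by gcongr
    have h3 := mul_meas_ge_le_lintegral₀ (μ := μ)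
      (f := fun ω => ENNReal.ofReal (Real.exp (r / τ * W ω))) (by fun_prop)
      (ENNReal.ofReal (Real.exp (c * L)))
    have h4 := (mul_le_mul_right h2 (ENNReal.ofReal (Real.exp (c * L)))).trans (h3.trans h1)
    have h5 : ENNReal.ofReal (Real.exp (4 * (r / τ) ^ 2 * τ ^ 2 * N))
        = ENNReal.ofReal (Real.exp (c * L)) * ENNReal.ofReal (Real.exp (-((c - 4) * L))) := by
      rw [← ENNReal.ofReal_mul (by positivity), ← Real.exp_add]
      congr 2
      rw [← hrsq]; field_simp; ring
    rw [h5] at h4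
    exact (ENNReal.mul_le_mul_iff_right (by simp [Real.exp_pos]) ENNReal.ofReal_ne_top).1 h4
  calc μ {ω | c * τ * r * N < |Z ω|}
      ≤ μ ({ω | c * τ * r * N < Z ω} ∪ {ω | c * τ * r * N < -Z ω}) :=
        measure_mono fun ω (hω : _ < |Z ω|) => lt_abs.1 hω
    _ ≤ ENNReal.ofReal (Real.exp (-((c - 4) * L))) + ENNReal.ofReal (Real.exp (-((c - 4) * L))) :=
        (measure_union_le _ _).trans (add_le_add (key _ h hZ) (key _ h.neg hZ.neg))
    _ = _ := by rw [← ENNReal.ofReal_add (by positivity) (by positivity)]; congr 1; ring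

/-- By the inequality `exp (a + b) ≤ (exp (2 a) + exp (2 b)) / 2`, a sum of two variables inherits
exponential moments from its summands, without any independence between them. -/
lemma lintegral_exp_add_le {W Z : Ω → ℝ} (hW : AEMeasurable W μ) {s e : ℝ}
    (h1 : ∫⁻ ω, ENNReal.ofReal (Real.exp (2 * s * W ω)) ∂μ ≤ ENNReal.ofReal (Real.exp e))
    (h2 : ∫⁻ ω, ENNReal.ofReal (Real.exp (2 * s * Z ω)) ∂μ ≤ ENNReal.ofReal (Real.exp e)) :
    ∫⁻ ω, ENNReal.ofReal (Real.exp (s * (W ω + Z ω))) ∂μ ≤ ENNReal.ofReal (Real.exp e) := by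
  calc ∫⁻ ω, ENNReal.ofReal (Real.exp (s * (W ω + Z ω))) ∂μ
      ≤ ∫⁻ ω, (ENNReal.ofReal (1 / 2) * ENNReal.ofReal (Real.exp (2 * s * W ω))
          + ENNReal.ofReal (1 / 2) * ENNReal.ofReal (Real.exp (2 * s * Z ω))) ∂μ := by
        refine lintegral_mono fun ω => ?_
        rw [← ENNReal.ofReal_mul (by norm_num), ← ENNReal.ofReal_mul (by norm_num),
          ← ENNReal.ofReal_add (by positivity) (by positivity)]
        refine ENNReal.ofReal_le_ofReal ?_
        rw [mul_add, Real.exp_add, mul_assoc, mul_assoc, two_mul (s * W ω), two_mul (s * Z ω),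
          Real.exp_add, Real.exp_add]
        nlinarith [sq_nonneg (Real.exp (s * W ω) - Real.exp (s * Z ω))]
    _ = ENNReal.ofReal (1 / 2) * ∫⁻ ω, ENNReal.ofReal (Real.exp (2 * s * W ω)) ∂μ
          + ENNReal.ofReal (1 / 2) * ∫⁻ ω, ENNReal.ofReal (Real.exp (2 * s * Z ω)) ∂μ := by
        rw [lintegral_add_left' (by fun_prop), lintegral_const_mul' _ _ ENNReal.ofReal_ne_top,
          lintegral_const_mul' _ _ ENNReal.ofReal_ne_top]
    _ ≤ ENNReal.ofReal (1 / 2) * ENNReal.ofReal (Real.exp e)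
          + ENNReal.ofReal (1 / 2) * ENNReal.ofReal (Real.exp e) := by gcongr
    _ = _ := by
        rw [← ENNReal.ofReal_mul (by norm_num), ← ENNReal.ofReal_add (by positivity)
          (by positivity)]
        congr 1; ring

/-- A weighted sum is sub-exponential at the weighted sum of the scales. No independence is needed:
Jensen's inequality with the weights `|c x| τ x / q` reduces the claim to the single variables. -/
lemma HasSubexpMGF.sum {κ : Type*} (S : Finset κ) (c τ : κ → ℝ) (Z : κ → Ω → ℝ) {q N : ℝ}
    [IsProbabilityMeasure μ] (hN : 0 ≤ N) (hq : 0 < q) (hτ : ∀ x ∈ S, 0 < τ x)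
    (hZm : ∀ x ∈ S, AEMeasurable (Z x) μ)
    (hZ : ∀ x ∈ S, c x ≠ 0 → HasSubexpMGF (Z x) (τ x) N μ) (hsum : ∑ x ∈ S, |c x| * τ x ≤ q) :
    HasSubexpMGF (fun ω => ∑ x ∈ S, c x * Z x ω) q N μ := by
  intro s hs
  set e := 4 * s ^ 2 * q ^ 2 * N with he
  set P : κ → ℝ := fun x => |c x| * τ x / q with hP
  have hP0 : ∀ x ∈ S, 0 ≤ P x := fun x hx => by have := hτ x hx; positivity
  have hP1 : ∑ x ∈ S, P x ≤ 1 := by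
    rw [hP, ← Finset.sum_div, div_le_one hq]; exact hsum
  set y : κ → ℝ := fun x => s * q * SignType.sign (c x) / τ x with hy
  have hPy : ∀ x ∈ S, P x * y x = s * c x := by
    intro x hx
    have := hτ x hx
    rw [hP, hy]
    field_simp
    rw [mul_comm (|c x|), mul_assoc, mul_comm (|c x|), sign_mul_abs]
  -- The signs and the scales are chosen so that every `y x * Z x` is tested at `|s| q ≤ 1 / 4`.
  have hmom : ∀ x ∈ S, ENNReal.ofReal (P x) * ∫⁻ ω, ENNReal.ofReal (Real.exp (y x * Z x ω)) ∂μ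
      ≤ ENNReal.ofReal (P x) * ENNReal.ofReal (Real.exp e) := by
    intro x hx
    have hx0 := hτ x hx
    rcases eq_or_ne (c x) 0 with h0 | h0
    · simp [hP, h0]
    gcongr
    have hsg : |((SignType.sign (c x) : SignType) : ℝ)| = 1 := by
      rcases lt_or_gt_of_ne h0 with h | h <;> simp [sign_neg, sign_pos, h]
    have habs : |y x| * τ x = |s| * q := by
      rw [hy, abs_div, abs_mul, abs_mul, hsg, abs_of_pos hq, abs_of_pos hx0]
      field_simp
    refine (hZ x hx h0 (y x) (habs ▸ hs)).trans_eq ?_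
    congr 2
    have hsq : (y x) ^ 2 * τ x ^ 2 = s ^ 2 * q ^ 2 := by
      rw [← sq_abs (y x), ← mul_pow, habs, mul_pow, sq_abs]
    rw [he, mul_assoc 4, hsq, ← mul_assoc]
  have hJ : ∀ ω, Real.exp (s * ∑ x ∈ S, c x * Z x ω)
      ≤ (1 - ∑ x ∈ S, P x) + ∑ x ∈ S, P x * Real.exp (y x * Z x ω) := by
    intro ω
    -- The missing weight is put on an additional point, where the exponent is zero.
    have h := convexOn_exp.map_sum_le (t := Finset.insertNone S)
      (w := fun o : Option κ => o.elim (1 - ∑ x ∈ S, P x) P) (p := fun o : Option κ => o.elim 0 fun x => y x * Z x ω)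
      (by
        intro o ho
        cases o with
        | none => simpa using hP1
        | some x => exact hP0 x (by simpa using ho))
      (by simp [Finset.sum_insertNone]) (by simp)
    simp only [Finset.sum_insertNone, Option.elim, smul_eq_mul, mul_zero, zero_add, Real.exp_zero,
      mul_one] at h
    refine le_trans (le_of_eq ?_) h
    congr 1
    rw [Finset.mul_sum]
    refine Finset.sum_congr rfl fun x hx => ?_
    rw [← mul_assoc, ← mul_assoc, hPy x hx]
  have h1e : 1 ≤ Real.exp e := Real.one_le_exp (by positivity)
  calc ∫⁻ ω, ENNReal.ofReal (Real.exp (s * ∑ x ∈ S, c x * Z x ω)) ∂μ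
      ≤ ∫⁻ ω, (ENNReal.ofReal (1 - ∑ x ∈ S, P x)
          + ∑ x ∈ S, ENNReal.ofReal (P x) * ENNReal.ofReal (Real.exp (y x * Z x ω))) ∂μ := by
        refine lintegral_mono fun ω => (ENNReal.ofReal_le_ofReal (hJ ω)).trans_eq ?_
        rw [ENNReal.ofReal_add (by linarith) (Finset.sum_nonneg fun x hx =>
          mul_nonneg (hP0 x hx) (Real.exp_pos _).le), ENNReal.ofReal_sum_of_nonneg fun x hx =>
          mul_nonneg (hP0 x hx) (Real.exp_pos _).le]
        congr 1
        exact Finset.sum_congr rfl fun x hx => ENNReal.ofReal_mul (hP0 x hx)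
    _ = ENNReal.ofReal (1 - ∑ x ∈ S, P x)
          + ∑ x ∈ S, ENNReal.ofReal (P x) * ∫⁻ ω, ENNReal.ofReal (Real.exp (y x * Z x ω)) ∂μ := by
        rw [lintegral_add_left' (by fun_prop), lintegral_finsetSum']
        · simp only [lintegral_const_mul' _ _ ENNReal.ofReal_ne_top]
          simp
        · intro x hx
          have := hZm x hx
          fun_prop
    _ ≤ ENNReal.ofReal (1 - ∑ x ∈ S, P x)
          + ∑ x ∈ S, ENNReal.ofReal (P x) * ENNReal.ofReal (Real.exp e) :=
        add_le_add_right (Finset.sum_le_sum hmom) _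
    _ = ENNReal.ofReal ((1 - ∑ x ∈ S, P x) + (∑ x ∈ S, P x) * Real.exp e) := by
        rw [← Finset.sum_mul, ← ENNReal.ofReal_sum_of_nonneg hP0,
          ← ENNReal.ofReal_mul (Finset.sum_nonneg hP0), ← ENNReal.ofReal_add (by linarith)
          (mul_nonneg (Finset.sum_nonneg hP0) (Real.exp_pos _).le)]
    _ ≤ ENNReal.ofReal (Real.exp e) := by
        refine ENNReal.ofReal_le_ofReal ?_
        nlinarith

end Moments

/-! ### Lagged products of an independent array -/

section LaggedProducts

variable {Ω : Type*} [MeasurableSpace Ω] {μ : Measure Ω}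

lemma lintegral_exp_sum_mul_le {ι κ : Type*} [IsProbabilityMeasure μ]
    {X : ι → Ω → ℝ} (hX : ∀ i, Measurable (X i)) (hind : iIndepFun X μ) (f g : κ → ι)
    (hf : f.Injective) (hg : g.Injective) (hfg : ∀ a b, f a ≠ g b) {v c : ℝ≥0} (hv : v ≠ 0)
    (hgauss : ∀ a, HasLaw (X (f a)) (gaussianReal 0 v) μ)
    (hsub : ∀ a, HasSubgaussianMGF (X (g a)) c μ) (S : Finset κ) {s : ℝ}
    (hs : 2 * (s ^ 2 * v * c) ≤ 1) :
    ∫⁻ ω, ENNReal.ofReal (Real.exp (s * ∑ t ∈ S, X (f t) ω * X (g t) ω)) ∂μ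
      ≤ ENNReal.ofReal (Real.exp (s ^ 2 * v * c * S.card)) := by
  classical
  have h1 : ∀ ω, ENNReal.ofReal (Real.exp (s * ∑ t ∈ S, X (f t) ω * X (g t) ω))
      = ∏ t ∈ S, ENNReal.ofReal (Real.exp (s * (X (f t) ω * X (g t) ω))) := fun ω => by
    rw [Finset.mul_sum, Real.exp_sum, ENNReal.ofReal_prod_of_nonneg fun _ _ => (Real.exp_pos _).le]
  simp only [h1]
  rw [lintegral_prod_pairs hX hind f g hf hg (fun a b _ => hfg a b)
    (fun x y => ENNReal.ofReal (Real.exp (s * (x * y)))) (by fun_prop) S]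
  calc _ ≤ ∏ _t ∈ S, ENNReal.ofReal (Real.exp (s ^ 2 * v * c)) :=
        Finset.prod_le_prod' fun t _ => lintegral_exp_mul_mul_le hv (hX _) (hX _)
          (hind.indepFun (hfg t t)) (hgauss t) (hsub t) hs
    _ = _ := by
        rw [Finset.prod_const, ← ENNReal.ofReal_pow (Real.exp_pos _).le, ← Real.exp_nat_mul]
        congr 2; ring

variable {J : Type*} {M : ℕ} {X : ℕ → J → Ω → ℝ}

/-- The lagged products `X (t - k) β * X (t - r) α` over a set of times on which the two index sets
do not meet. -/
lemma lintegral_exp_sum_lag_mul_le [IsProbabilityMeasure μ]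
    (hX : ∀ t < M, ∀ α, Measurable (X t α))
    (hind : iIndepFun (fun k : Fin M × J => X k.1 k.2) μ) {α β : J} {v c : ℝ≥0} (hv : v ≠ 0)
    (hgauss : ∀ t < M, HasLaw (X t β) (gaussianReal 0 v) μ)
    (hsub : ∀ t < M, HasSubgaussianMGF (X t α) c μ) {k r : ℕ} (S : Finset ℕ)
    (hS : ∀ t ∈ S, t < M ∧ k ≤ t ∧ r ≤ t)
    (hdisj : ∀ a ∈ S, ∀ b ∈ S, a - k = b - r → β ≠ α) {s : ℝ} (hs : 2 * (s ^ 2 * v * c) ≤ 1) :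
    ∫⁻ ω, ENNReal.ofReal (Real.exp (s * ∑ t ∈ S, X (t - k) β ω * X (t - r) α ω)) ∂μ
      ≤ ENNReal.ofReal (Real.exp (s ^ 2 * v * c * S.card)) := by
  have hlt : ∀ (j : ℕ) (t : S), t.1 - j < M := fun j t =>
    (Nat.sub_le _ _).trans_lt (hS t.1 t.2).1
  have h := lintegral_exp_sum_mul_le (X := fun k : Fin M × J => X k.1 k.2)
    (fun i => hX _ i.1.2 _) hind (fun t : S => (⟨t.1 - k, hlt k t⟩, β))
    (fun t : S => (⟨t.1 - r, hlt r t⟩, α))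
    (fun a b hab => by
      have := congrArg Fin.val (Prod.ext_iff.1 hab).1
      have h1 := hS a.1 a.2; have h2 := hS b.1 b.2
      simp only at this
      exact Subtype.ext (by omega))
    (fun a b hab => by
      have := congrArg Fin.val (Prod.ext_iff.1 hab).1
      have h1 := hS a.1 a.2; have h2 := hS b.1 b.2
      simp only at this
      exact Subtype.ext (by omega))
    (fun a b hab => hdisj a.1 a.2 b.1 b.2 (congrArg Fin.val (Prod.ext_iff.1 hab).1)
      (Prod.ext_iff.1 hab).2)
    hv (fun a => hgauss _ (hlt k a)) (fun a => hsub _ (hlt r a)) S.attach hs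
  have hatt : ∀ ω, ∑ t ∈ S.attach, X (t.1 - k) β ω * X (t.1 - r) α ω
      = ∑ t ∈ S, X (t - k) β ω * X (t - r) α ω := fun ω =>
    Finset.sum_attach S fun t => X (t - k) β ω * X (t - r) α ω
  simpa only [hatt, Finset.card_attach] using h

lemma measurable_sum_lag_mul (hX : ∀ t < M, ∀ α, Measurable (X t α)) (α β : J) {k r : ℕ}
    (S : Finset ℕ) (hS : ∀ t ∈ S, t < M) :
    Measurable fun ω => ∑ t ∈ S, X (t - k) β ω * X (t - r) α ω :=
  Finset.measurable_sum _ fun t ht =>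
    (hX _ ((Nat.sub_le _ _).trans_lt (hS t ht)) _).mul (hX _ ((Nat.sub_le _ _).trans_lt (hS t ht)) _)

/-- Products of two different entries at fixed lags `k` and `r`, summed over time. Two products
share a variable only if their times differ by `d = |k - r|`, so that splitting the times according
to the parity of `t / d` leaves two sums of independent products. -/
lemma hasSubexpMGF_sum_lag_mul [IsProbabilityMeasure μ]
    (hX : ∀ t < M, ∀ α, Measurable (X t α))
    (hind : iIndepFun (fun k : Fin M × J => X k.1 k.2) μ) {α β : J} {σ τ : ℝ≥0} (hσ : σ ≠ 0)
    (hgauss : ∀ t < M, HasLaw (X t β) (gaussianReal 0 (σ ^ 2)) μ)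
    (hsub : ∀ t < M, HasSubgaussianMGF (X t α) (τ ^ 2) μ) {k r : ℕ} (S : Finset ℕ)
    (hS : ∀ t ∈ S, t < M ∧ k ≤ t ∧ r ≤ t) (hne : k = r → β ≠ α) {N : ℝ} (hN : (S.card : ℝ) ≤ N) :
    HasSubexpMGF (fun ω => ∑ t ∈ S, X (t - k) β ω * X (t - r) α ω) (σ * τ) N μ := by
  intro s hs
  have hst : s ^ 2 * (σ * τ) ^ 2 ≤ 1 / 16 := by
    rw [← sq_abs s, ← mul_pow]
    calc (|s| * (σ * τ : ℝ)) ^ 2 ≤ (1 / 4) ^ 2 := by gcongr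
      _ = 1 / 16 := by norm_num
  have hmono : ∀ S' ⊆ S, (S'.card : ℝ) ≤ N := fun S' h =>
    le_trans (by exact_mod_cast Finset.card_le_card h) hN
  rcases eq_or_ne k r with hkr | hkr
  · refine (lintegral_exp_sum_lag_mul_le hX hind (pow_ne_zero 2 hσ) hgauss hsub S hS
      (fun _ _ _ _ _ => hne hkr) (s := s) ?_).trans ?_
    · push_cast; nlinarith
    · refine ENNReal.ofReal_le_ofReal (Real.exp_le_exp.2 ?_)
      push_cast
      calc s ^ 2 * (σ : ℝ) ^ 2 * (τ : ℝ) ^ 2 * S.card ≤ s ^ 2 * (σ : ℝ) ^ 2 * (τ : ℝ) ^ 2 * N := by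
            gcongr
        _ ≤ 4 * (s ^ 2 * (σ : ℝ) ^ 2 * (τ : ℝ) ^ 2 * N) :=
            le_mul_of_one_le_left (mul_nonneg (by positivity) ((Nat.cast_nonneg _).trans hN))
              (by norm_num)
        _ = _ := by ring
  · set d := (k - r) + (r - k) with hd
    have hd0 : 0 < d := by omega
    have hpar : ∀ a ∈ S, ∀ b ∈ S, a - k = b - r → ¬ (a / d % 2 = b / d % 2) := by
      intro a ha b hb hab
      have h1 := hS a ha; have h2 := hS b hb
      rcases lt_or_gt_of_ne hkr with h | h
      · have : b = a + d := by omega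
        rw [this, Nat.add_div_right _ hd0]; omega
      · have : a = b + d := by omega
        rw [this, Nat.add_div_right _ hd0]; omega
    have key : ∀ S' ⊆ S, (∀ a ∈ S', ∀ b ∈ S', a / d % 2 = b / d % 2) →
        ∫⁻ ω, ENNReal.ofReal (Real.exp (2 * s * ∑ t ∈ S', X (t - k) β ω * X (t - r) α ω)) ∂μ
          ≤ ENNReal.ofReal (Real.exp (4 * s ^ 2 * (σ * τ : ℝ) ^ 2 * N)) := by
      intro S' hS' hp
      refine (lintegral_exp_sum_lag_mul_le hX hind (pow_ne_zero 2 hσ) hgauss hsub S'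
        (fun t ht => hS t (hS' ht))
        (fun a ha b hb hab => absurd (hp a ha b hb) (hpar a (hS' ha) b (hS' hb) hab))
        (s := 2 * s) ?_).trans ?_
      · push_cast; nlinarith
      · refine ENNReal.ofReal_le_ofReal (Real.exp_le_exp.2 ?_)
        push_cast
        calc (2 * s) ^ 2 * (σ : ℝ) ^ 2 * (τ : ℝ) ^ 2 * S'.card
            ≤ (2 * s) ^ 2 * (σ : ℝ) ^ 2 * (τ : ℝ) ^ 2 * N := by
              gcongr; exact hmono S' hS'
          _ = _ := by ring
    have hsplit : ∀ ω, ∑ t ∈ S, X (t - k) β ω * X (t - r) α ω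
        = ∑ t ∈ S with t / d % 2 = 0, X (t - k) β ω * X (t - r) α ω
          + ∑ t ∈ S with ¬ t / d % 2 = 0, X (t - k) β ω * X (t - r) α ω := fun ω =>
      (Finset.sum_filter_add_sum_filter_not S _ _).symm
    simp only [hsplit]
    refine lintegral_exp_add_le (measurable_sum_lag_mul hX α β _
      fun t ht => (hS t (Finset.mem_filter.1 ht).1).1).aemeasurable
      (key _ (Finset.filter_subset _ _) fun a ha b hb => ?_)
      (key _ (Finset.filter_subset _ _) fun a ha b hb => ?_)
    · rw [(Finset.mem_filter.1 ha).2, (Finset.mem_filter.1 hb).2]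
    · have h1 := (Finset.mem_filter.1 ha).2
      have h2 := (Finset.mem_filter.1 hb).2
      omega

lemma hasSubexpMGF_sum_lag_sq_sub [IsProbabilityMeasure μ]
    (hX : ∀ t < M, ∀ α, Measurable (X t α))
    (hind : iIndepFun (fun k : Fin M × J => X k.1 k.2) μ) {β : J} {σ : ℝ≥0} (hσ : σ ≠ 0)
    (hgauss : ∀ t < M, HasLaw (X t β) (gaussianReal 0 (σ ^ 2)) μ) {k : ℕ} (S : Finset ℕ)
    (hS : ∀ t ∈ S, t < M ∧ k ≤ t) :
    HasSubexpMGF (fun ω => ∑ t ∈ S, (X (t - k) β ω * X (t - k) β ω - (σ : ℝ) ^ 2))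
      (σ * σ) S.card μ := by
  classical
  intro s hs
  have hlt : ∀ t : S, t.1 - k < M := fun t => (Nat.sub_le _ _).trans_lt (hS t.1 t.2).1
  set f : S → Fin M × J := fun t => (⟨t.1 - k, hlt t⟩, β) with hfdef
  have hf : f.Injective := fun a b hab => by
    have := congrArg Fin.val (Prod.ext_iff.1 hab).1
    have h1 := hS a.1 a.2; have h2 := hS b.1 b.2
    simp only [hfdef] at this
    exact Subtype.ext (by omega)
  have h1 : ∀ ω, ENNReal.ofReal
        (Real.exp (s * ∑ t ∈ S, (X (t - k) β ω * X (t - k) β ω - (σ : ℝ) ^ 2)))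
      = ∏ t ∈ S.attach, ENNReal.ofReal
        (Real.exp (s * (X (f t).1 (f t).2 ω * X (f t).1 (f t).2 ω - (σ : ℝ) ^ 2))) := fun ω => by
    rw [← Finset.sum_attach, Finset.mul_sum, Real.exp_sum,
      ENNReal.ofReal_prod_of_nonneg fun _ _ => (Real.exp_pos _).le]
  simp only [h1]
  rw [lintegral_prod_pairs (X := fun k : Fin M × J => X k.1 k.2) (fun i => hX _ i.1.2 _) hind f f
    hf hf (fun a b hab h => hab (hf h))
    (fun x y => ENNReal.ofReal (Real.exp (s * (x * y - (σ : ℝ) ^ 2)))) (by fun_prop)]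
  calc _ ≤ ∏ _t ∈ S.attach, ENNReal.ofReal (Real.exp (4 * s ^ 2 * ((σ : ℝ) * σ) ^ 2)) := by
        refine Finset.prod_le_prod' fun t _ => ?_
        have := lintegral_exp_mul_sq_sub_le (pow_ne_zero 2 hσ) (hgauss _ (hlt t)) (s := s)
          (by push_cast; rwa [sq])
        push_cast at this
        refine this.trans_eq ?_
        congr 2; ring
    _ = _ := by
        rw [Finset.prod_const, ← ENNReal.ofReal_pow (Real.exp_pos _).le, ← Real.exp_nat_mul,
          Finset.card_attach]
        congr 2; ring

end LaggedProducts

/-! ### The regression noise as a weighted sum of lagged sources -/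

section Regression

variable {n p m : ℕ}

lemma sum_abs_le_rowL1Norm {ι κ : Type*} [Finite ι] [Fintype κ] (M : Matrix ι κ ℝ) (i : ι) :
    ∑ j, |M i j| ≤ rowL1Norm M :=
  le_ciSup (f := fun i => ∑ j, |M i j|) (Set.finite_range _).bddAbove i

lemma rowL1Norm_nonneg {ι κ : Type*} [Fintype κ] (M : Matrix ι κ ℝ) : 0 ≤ rowL1Norm M :=
  Real.iSup_nonneg fun _ => Finset.sum_nonneg fun _ _ => abs_nonneg _

lemma sum_abs_mul_le {ι κ l : Type*} [Fintype κ] [Fintype l] (M : Matrix ι κ ℝ)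
    (M' : Matrix κ l ℝ) (i : ι) {a b : ℝ} (hM : ∑ k, |M i k| ≤ a) (hM' : rowL1Norm M' ≤ b) :
    ∑ j, |(M * M') i j| ≤ a * b := by
  have hb : 0 ≤ b := (rowL1Norm_nonneg M').trans hM'
  calc ∑ j, |(M * M') i j| ≤ ∑ j, ∑ k, |M i k| * |M' k j| := by
        refine Finset.sum_le_sum fun j _ => ?_
        rw [Matrix.mul_apply]
        exact (Finset.abs_sum_le_sum_abs _ _).trans_eq (by simp only [abs_mul])
    _ = ∑ k, |M i k| * ∑ j, |M' k j| := by
        rw [Finset.sum_comm]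
        simp only [Finset.mul_sum]
    _ ≤ ∑ k, |M i k| * b := by
        gcongr with k
        exact (sum_abs_le_rowL1Norm M' k).trans hM'
    _ = (∑ k, |M i k|) * b := by rw [Finset.sum_mul]
    _ ≤ a * b := by gcongr

lemma state_eq_sum (A : Matrix (Fin n) (Fin n) ℝ) (B : Matrix (Fin n) (Fin p) ℝ)
    (u : ℕ → Fin p → ℝ) (w : ℕ → Fin n → ℝ) (t : ℕ) :
    state A B u w t
      = ∑ r ∈ Finset.range t, (A ^ r) *ᵥ (B *ᵥ u (t - (r + 1)) + w (t - (r + 1))) := by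
  induction t with
  | zero => simp [state]
  | succ t ih =>
    rw [state, ih, Finset.sum_range_succ']
    simp only [Matrix.mulVec_sum, Matrix.mulVec_mulVec, ← pow_succ', pow_zero, Matrix.one_mulVec,
      zero_add, Nat.add_sub_cancel]
    rw [add_assoc]
    simp only [Nat.add_sub_add_right]

/-- The coefficient of the source `α` at lag `r` in the part of output `i` that the regression on
the last `T` inputs leaves unexplained: older inputs, process noise and observation noise. -/
def noiseCoeff (A : Matrix (Fin n) (Fin n) ℝ) (B : Matrix (Fin n) (Fin p) ℝ)
    (C : Matrix (Fin m) (Fin n) ℝ) (T : ℕ) (i : Fin m) (r : ℕ) : Fin p ⊕ Fin n ⊕ Fin m → ℝ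
  | .inl l => if T ≤ r then (C * A ^ (r - 1) * B) i l else 0
  | .inr (.inl l) => if 1 ≤ r then (C * A ^ (r - 1)) i l else 0
  | .inr (.inr l) => if r = 0 ∧ l = i then 1 else 0

lemma output_eq_markovMatrix_mulVec_add {Ω : Type*} (A : Matrix (Fin n) (Fin n) ℝ)
    (B : Matrix (Fin n) (Fin p) ℝ) (C : Matrix (Fin m) (Fin n) ℝ) (D : Matrix (Fin m) (Fin p) ℝ)
    (u : ℕ → Ω → Fin p → ℝ) (w : ℕ → Ω → Fin n → ℝ) (v : ℕ → Ω → Fin m → ℝ) (ω : Ω)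
    {T t : ℕ} (hT : 1 ≤ T) (ht : T - 1 ≤ t) (i : Fin m) :
    output A B C D (fun t => u t ω) (fun t => w t ω) (fun t => v t ω) t i
      = (markovMatrix A B C D T *ᵥ stackedInput T (fun t => u t ω) t) i
        + ∑ r ∈ Finset.range (t + 1), ∑ α, noiseCoeff A B C T i r α * source u w v (t - r) α ω := by
  set g : ℕ → ℝ := fun k =>
    ∑ j, (if k = 0 then D i j else (C * A ^ (k - 1) * B) i j) * u (t - k) ω j with hg
  have hG : (markovMatrix A B C D T *ᵥ stackedInput T (fun t => u t ω) t) i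
      = ∑ k ∈ Finset.range T, g k := by
    rw [Finset.sum_range, Matrix.mulVec, dotProduct, Fintype.sum_prod_type]
    rfl
  have hsplit : ∑ k ∈ Finset.range (t + 1), g k
      = ∑ k ∈ Finset.range T, g k + ∑ k ∈ Finset.range (t + 1), if T ≤ k then g k else 0 := by
    rw [← Finset.sum_filter, ← Finset.sum_range_add_sum_Ico g (show T ≤ t + 1 by omega)]
    congr 2
    ext k
    simp only [Finset.mem_Ico, Finset.mem_filter, Finset.mem_range]
    tauto
  have hin : ∀ r, (if T ≤ r then g r else 0)
      = ∑ l, noiseCoeff A B C T i r (.inl l) * u (t - r) ω l := by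
    intro r
    split_ifs with h
    · have h0 : r ≠ 0 := by omega
      simp [hg, noiseCoeff, h, h0]
    · simp [noiseCoeff, h]
  have hw : ∑ r ∈ Finset.range (t + 1), ∑ l,
        noiseCoeff A B C T i r (.inr (.inl l)) * w (t - r) ω l
      = ∑ r ∈ Finset.range t, ((C * A ^ r) *ᵥ w (t - (r + 1)) ω) i := by
    rw [Finset.sum_range_succ']
    simp [noiseCoeff, Matrix.mulVec, dotProduct]
  have hv : ∑ r ∈ Finset.range (t + 1), ∑ l,
        noiseCoeff A B C T i r (.inr (.inr l)) * v (t - r) ω l = v t ω i := by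
    rw [Finset.sum_range_succ']
    simp [noiseCoeff]
  have hu : ∑ k ∈ Finset.range (t + 1), g k
      = ∑ r ∈ Finset.range t, ((C * A ^ r * B) *ᵥ u (t - (r + 1)) ω) i + (D *ᵥ u t ω) i := by
    rw [Finset.sum_range_succ']
    simp [hg, Matrix.mulVec, dotProduct]
  have hy : output A B C D (fun t => u t ω) (fun t => w t ω) (fun t => v t ω) t i
      = ∑ r ∈ Finset.range t, ((C * A ^ r * B) *ᵥ u (t - (r + 1)) ω) i
        + ∑ r ∈ Finset.range t, ((C * A ^ r) *ᵥ w (t - (r + 1)) ω) i + (D *ᵥ u t ω) i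
        + v t ω i := by
    rw [output, state_eq_sum]
    simp only [Pi.add_apply, Matrix.mulVec_sum, Matrix.mulVec_add, Matrix.mulVec_mulVec,
      Finset.sum_apply, Finset.sum_add_distrib, Matrix.mul_assoc]
  rw [hy, hG]
  simp only [Fintype.sum_sum_type, source, Finset.sum_add_distrib]
  rw [hw, hv]
  simp only [← hin]
  linarith

/-- The scale of a source: the standard deviation of the inputs and the sub-Gaussian parameters of
the two noises. -/
def sourceScale (σu σw σv : ℝ≥0) : Fin p ⊕ Fin n ⊕ Fin m → ℝ≥0
  | .inl _ => σu
  | .inr (.inl _) => σw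
  | .inr (.inr _) => σv

lemma sum_range_ite_pow_le {ρ : ℝ} (hρ0 : 0 ≤ ρ) (hρ1 : ρ < 1) {a : ℝ} (ha : 0 ≤ a) {T : ℕ}
    (hT : 1 ≤ T) (R : ℕ) :
    ∑ r ∈ Finset.range R, (if T ≤ r then a * ρ ^ (r - 1) else 0) ≤ a * (ρ ^ (T - 1) / (1 - ρ)) := by
  have hf : (Finset.range R).filter (fun r => T ≤ r) = Finset.Ico T R := by
    ext k; simp; tauto
  rw [← Finset.sum_filter, hf, ← Finset.mul_sum, Finset.sum_Ico_eq_sum_range]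
  gcongr
  calc ∑ k ∈ Finset.range (R - T), ρ ^ (T + k - 1)
      = ρ ^ (T - 1) * ∑ k ∈ Finset.range (R - T), ρ ^ k := by
        rw [Finset.mul_sum]
        refine Finset.sum_congr rfl fun k _ => ?_
        rw [← pow_add]; congr 1; omega
    _ ≤ ρ ^ (T - 1) * (1 / (1 - ρ)) := by
        gcongr
        rw [le_div_iff₀ (by linarith), geom_sum_mul_neg]
        linarith [pow_nonneg hρ0 (R - T)]
    _ = _ := by ring

section Stable

variable {A : Matrix (Fin n) (Fin n) ℝ} {B : Matrix (Fin n) (Fin p) ℝ}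
  {C : Matrix (Fin m) (Fin n) ℝ} {D : Matrix (Fin m) (Fin p) ℝ} {Csys ρ : ℝ}

lemma sum_abs_mul_pow_le (hA : ∀ τ : ℕ, rowL1Norm (A ^ τ) ≤ Csys * ρ ^ τ)
    (hC : rowL1Norm C ≤ Csys) (i : Fin m) (τ : ℕ) :
    ∑ j, |(C * A ^ τ) i j| ≤ Csys ^ 2 * ρ ^ τ :=
  (sum_abs_mul_le C (A ^ τ) i ((sum_abs_le_rowL1Norm C i).trans hC) (hA τ)).trans_eq (by ring)

lemma sum_abs_mul_pow_mul_le (hA : ∀ τ : ℕ, rowL1Norm (A ^ τ) ≤ Csys * ρ ^ τ)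
    (hB : rowL1Norm B ≤ Csys) (hC : rowL1Norm C ≤ Csys) (i : Fin m) (τ : ℕ) :
    ∑ j, |(C * A ^ τ * B) i j| ≤ Csys ^ 3 * ρ ^ τ :=
  (sum_abs_mul_le _ B i (sum_abs_mul_pow_le hA hC i τ) hB).trans_eq (by ring)

lemma sum_noiseCoeff_le (h1 : 1 ≤ Csys) (hρ0 : 0 ≤ ρ) (hρ1 : ρ < 1)
    (hA : ∀ τ : ℕ, rowL1Norm (A ^ τ) ≤ Csys * ρ ^ τ)
    (hB : rowL1Norm B ≤ Csys) (hC : rowL1Norm C ≤ Csys) {T : ℕ} (hT : 1 ≤ T) (i : Fin m) (R : ℕ)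
    (σu σw σv : ℝ≥0) :
    ∑ r ∈ Finset.range R, ∑ α, |noiseCoeff A B C T i r α| * sourceScale σu σw σv α
      ≤ Csys ^ 3 * (ρ ^ (T - 1) / (1 - ρ)) * σu + Csys ^ 2 / (1 - ρ) * σw + σv := by
  have hC0 : 0 ≤ Csys := by linarith
  simp only [Fintype.sum_sum_type, sourceScale, ← Finset.sum_mul, Finset.sum_add_distrib]
  rw [add_assoc]
  have hbu : ∑ r ∈ Finset.range R, ∑ l, |noiseCoeff A B C T i r (.inl l)|
      ≤ Csys ^ 3 * (ρ ^ (T - 1) / (1 - ρ)) := by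
    refine le_trans (Finset.sum_le_sum fun r _ => ?_)
      (sum_range_ite_pow_le hρ0 hρ1 (by positivity : 0 ≤ Csys ^ 3) hT R)
    split_ifs with h
    · simpa [noiseCoeff, h] using sum_abs_mul_pow_mul_le hA hB hC i (r - 1)
    · simp [noiseCoeff, h]
  have hbw : ∑ r ∈ Finset.range R, ∑ l, |noiseCoeff A B C T i r (.inr (.inl l))|
      ≤ Csys ^ 2 / (1 - ρ) := by
    refine le_trans (Finset.sum_le_sum fun r _ => ?_)
      ((sum_range_ite_pow_le hρ0 hρ1 (by positivity : 0 ≤ Csys ^ 2) le_rfl R).trans_eq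
        (by simp [div_eq_mul_inv]))
    split_ifs with h
    · simpa [noiseCoeff, h] using sum_abs_mul_pow_le hA hC i (r - 1)
    · simp [noiseCoeff, h]
  have hbv : ∑ r ∈ Finset.range R, ∑ l, |noiseCoeff A B C T i r (.inr (.inr l))| ≤ 1 := by
    calc _ ≤ ∑ r ∈ Finset.range R, if r = 0 then (1 : ℝ) else 0 := by
          refine Finset.sum_le_sum fun r _ => ?_
          by_cases h : r = 0 <;> simp [noiseCoeff, h, apply_ite abs]
      _ ≤ 1 := by
          rw [Finset.sum_ite_eq']
          split_ifs <;> norm_num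
  have := mul_le_mul_of_nonneg_right hbu σu.2
  have := mul_le_mul_of_nonneg_right hbw σw.2
  have := mul_le_mul_of_nonneg_right hbv σv.2
  simp only [NNReal.val_eq_coe, one_mul] at *
  linarith

lemma sum_abs_markovMatrix_le (h1 : 1 ≤ Csys) (hρ0 : 0 ≤ ρ) (hρ1 : ρ < 1)
    (hA : ∀ τ : ℕ, rowL1Norm (A ^ τ) ≤ Csys * ρ ^ τ) (hB : rowL1Norm B ≤ Csys)
    (hC : rowL1Norm C ≤ Csys) (hD : rowL1Norm D ≤ Csys) (T : ℕ) (i : Fin m) :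
    ∑ kj, |markovMatrix A B C D T i kj| ≤ 2 * (Csys ^ 3 / (1 - ρ)) := by
  have hC0 : 0 ≤ Csys := by linarith
  rw [Fintype.sum_prod_type]
  have hrow : ∀ k : ℕ, ∑ j, |if k = 0 then D i j else (C * A ^ (k - 1) * B) i j|
      ≤ (if k = 0 then Csys else 0) + if 1 ≤ k then Csys ^ 3 * ρ ^ (k - 1) else 0 := by
    intro k
    rcases Nat.eq_zero_or_pos k with rfl | hk
    · simpa using (sum_abs_le_rowL1Norm D i).trans hD
    · have hk' : 1 ≤ k := hk
      simpa [hk', hk.ne'] using sum_abs_mul_pow_mul_le hA hB hC i (k - 1)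
  calc ∑ k : Fin T, ∑ j, |markovMatrix A B C D T i (k, j)|
      ≤ ∑ k : Fin T, ((if (k : ℕ) = 0 then Csys else 0)
          + if 1 ≤ (k : ℕ) then Csys ^ 3 * ρ ^ ((k : ℕ) - 1) else 0) :=
        Finset.sum_le_sum fun k _ => hrow k
    _ = ∑ k ∈ Finset.range T, ((if k = 0 then Csys else 0)
          + if 1 ≤ k then Csys ^ 3 * ρ ^ (k - 1) else 0) :=
        (Finset.sum_range fun k => (if k = 0 then Csys else 0)
          + if 1 ≤ k then Csys ^ 3 * ρ ^ (k - 1) else 0).symm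
    _ ≤ Csys + Csys ^ 3 * (ρ ^ (1 - 1) / (1 - ρ)) := by
        rw [Finset.sum_add_distrib, Finset.sum_ite_eq']
        refine add_le_add ?_ (sum_range_ite_pow_le hρ0 hρ1 (by positivity) le_rfl T)
        split_ifs <;> linarith
    _ ≤ 2 * (Csys ^ 3 / (1 - ρ)) := by
        have h2 : Csys ≤ Csys ^ 3 / (1 - ρ) := by
          rw [le_div_iff₀ (by linarith)]
          calc Csys * (1 - ρ) ≤ Csys * 1 := by gcongr; linarith
            _ = Csys ^ 1 := by ring
            _ ≤ Csys ^ 3 := pow_le_pow_right₀ h1 (by norm_num)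
        rw [Nat.sub_self, pow_zero, ← mul_div_assoc, mul_one]
        linarith

end Stable

lemma two_le_of_horizonThreshold_le {n p T N : ℕ} {Csys ρ σu σw ε : ℝ} (h1 : 1 ≤ Csys)
    (hρ0 : 0 ≤ ρ) (hρ1 : ρ < 1) (hbig : 10 ≤ (N : ℝ) * n + (T : ℝ) * p)
    (hT : 32 * horizonThreshold n p T N Csys ρ σu σw ε ≤ T) : 2 ≤ T := by
  have h1ρ : 0 < 1 - ρ := by linarith
  have hexp : Real.exp 2 ≤ 10 := by
    have h := Real.exp_one_lt_d9
    have h0 := Real.exp_pos 1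
    rw [show (2 : ℝ) = 1 + 1 by norm_num, Real.exp_add]
    nlinarith
  have hlog : 2 ≤ Real.log ((N : ℝ) * n + (T : ℝ) * p) := by
    rw [Real.le_log_iff_exp_le (by linarith)]
    linarith
  have hll : 1 / 2 ≤ Real.log (Real.log ((N : ℝ) * n + (T : ℝ) * p)) := by
    have := Real.log_le_log (by norm_num) hlog
    linarith [Real.log_two_gt_d9]
  have ha0 : 0 ≤ Real.log (Csys / (1 - ρ)) :=
    Real.log_nonneg (by rw [le_div_iff₀ h1ρ]; linarith)
  have hlM : 0 ≤ Real.log (max 1 ((σw + σu) / ε)) := Real.log_nonneg (le_max_left _ _)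
  have hhalf : 1 / 2 ≤ horizonThreshold n p T N Csys ρ σu σw ε := by
    rw [horizonThreshold, le_div_iff₀ h1ρ]
    nlinarith
  have : (16 : ℝ) ≤ T := by linarith
  have : 16 ≤ T := by exact_mod_cast this
  omega

/-- The inputs older than `T` steps are negligible: as `T - 1 ≥ T / 2`, the horizon condition gives
`ρ ^ (T - 1) ≤ exp (-(1 - ρ) T / 2) ≤ (((1 - ρ) / Csys) * min 1 (ε / (σw + σu))) ^ 3`. -/
lemma truncation_le {n p T N : ℕ} {Csys ρ σu σw ε K : ℝ} (h1 : 1 ≤ Csys) (hρ0 : 0 ≤ ρ)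
    (hρ1 : ρ < 1) (hσu : 0 < σu) (hσw : 0 ≤ σw) (hε : 0 < ε) (hK : 6 ≤ K)
    (hbig : Real.exp 1 ≤ (N : ℝ) * n + (T : ℝ) * p) (hT2 : 2 ≤ T)
    (hT : K * horizonThreshold n p T N Csys ρ σu σw ε ≤ T) :
    Csys ^ 3 * (ρ ^ (T - 1) / (1 - ρ)) * σu ≤ ε := by
  have h1ρ : 0 < 1 - ρ := by linarith
  have hC0 : 0 < Csys := by linarith
  set a := Real.log (Csys / (1 - ρ)) with ha
  set M := max 1 ((σw + σu) / ε) with hM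
  have hM1 : 1 ≤ M := le_max_left _ _
  have hq1 : 1 ≤ Csys / (1 - ρ) := by rw [le_div_iff₀ h1ρ]; linarith
  have ha0 : 0 ≤ a := Real.log_nonneg hq1
  have hlM : 0 ≤ Real.log M := Real.log_nonneg hM1
  have hll : 0 ≤ Real.log (Real.log ((N : ℝ) * n + (T : ℝ) * p)) := by
    refine Real.log_nonneg ?_
    rw [Real.le_log_iff_exp_le (lt_of_lt_of_le (Real.exp_pos 1) hbig)]
    exact hbig
  have hsum : 6 * (a + Real.log M) ≤ (1 - ρ) * T := by
    have h2 : (a + Real.log M) / (1 - ρ) ≤ horizonThreshold n p T N Csys ρ σu σw ε := by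
      rw [horizonThreshold]
      gcongr
      linarith
    have h3 : 6 * ((a + Real.log M) / (1 - ρ)) ≤ T := by
      have h4 : 0 ≤ (a + Real.log M) / (1 - ρ) := by positivity
      calc 6 * ((a + Real.log M) / (1 - ρ)) ≤ K * horizonThreshold n p T N Csys ρ σu σw ε := by
            gcongr
        _ ≤ T := hT
    rw [mul_div_assoc', div_le_iff₀ h1ρ] at h3
    linarith
  have hpow : ρ ^ (T - 1) ≤ Real.exp (-3 * (a + Real.log M)) := by
    calc ρ ^ (T - 1) ≤ Real.exp (-(1 - ρ)) ^ (T - 1) := by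
          gcongr
          linarith [Real.add_one_le_exp (-(1 - ρ))]
      _ = Real.exp (-((T - 1 : ℕ) * (1 - ρ))) := by rw [← Real.exp_nat_mul]; congr 1; ring
      _ ≤ _ := by
          refine Real.exp_le_exp.2 ?_
          have hT2' : (2 : ℝ) ≤ T := by exact_mod_cast hT2
          push_cast [Nat.cast_sub (show 1 ≤ T by omega)]
          nlinarith
  have hexp : Real.exp (-3 * (a + Real.log M)) = ((1 - ρ) / Csys) ^ 3 * M⁻¹ ^ 3 := by
    rw [show -3 * (a + Real.log M) = ((3 : ℕ) : ℝ) * (-a) + ((3 : ℕ) : ℝ) * (-Real.log M) by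
      push_cast; ring, Real.exp_add, Real.exp_nat_mul, Real.exp_nat_mul, Real.exp_neg,
      Real.exp_neg, Real.exp_log (by positivity), Real.exp_log (by linarith), inv_div]
  have hMσ : M⁻¹ ^ 3 * σu ≤ ε := by
    have h5 : M⁻¹ ^ 3 ≤ M⁻¹ := by
      have : M⁻¹ ≤ 1 := inv_le_one_of_one_le₀ hM1
      calc M⁻¹ ^ 3 ≤ M⁻¹ ^ 1 := pow_le_pow_of_le_one (by positivity) this (by norm_num)
        _ = M⁻¹ := pow_one _
    have h6 : σu ≤ M * ε := by
      have := le_max_right 1 ((σw + σu) / ε)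
      rw [← hM, div_le_iff₀ hε] at this
      linarith
    calc M⁻¹ ^ 3 * σu ≤ M⁻¹ * (M * ε) := by gcongr
      _ = ε := by rw [inv_mul_cancel_left₀ (by linarith)]
  calc Csys ^ 3 * (ρ ^ (T - 1) / (1 - ρ)) * σu
      ≤ Csys ^ 3 * ((((1 - ρ) / Csys) ^ 3 * M⁻¹ ^ 3) / (1 - ρ)) * σu := by
        gcongr
        exact hpow.trans_eq hexp
    _ = (1 - ρ) ^ 2 * (M⁻¹ ^ 3 * σu) := by field_simp
    _ ≤ 1 * ε := by
        gcongr
        exact pow_le_one₀ h1ρ.le (by linarith)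
    _ = ε := one_mul ε

end Regression

/-! ### The slow-rate bound for the lasso -/

section Lasso

/-- The slow-rate analysis of one `ℓ₁`-regularized regression. The minimality of `x` gives
`‖x‖₁ ≤ 3 ‖g‖₁` and a bound for the prediction error; since the empirical second moments of the
regressors are entrywise close to those of white noise, the prediction error controls
`σ² ‖g - x‖₂²` up to a multiple of `‖g - x‖₁²`. -/
lemma sum_sq_sub_le_of_lasso {κ : Type*} [Fintype κ] [DecidableEq κ] (S : Finset ℕ)
    (U : ℕ → κ → ℝ) (e : ℕ → ℝ) (g x : κ → ℝ) {N lam R δ σ2 : ℝ} (hN : 0 < N) (hlam : 0 < lam)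
    (hδ : 0 ≤ δ) (hσ : 0 < σ2)
    (hmin : 1 / (2 * N) * ∑ t ∈ S, ((g ⬝ᵥ U t + e t) - x ⬝ᵥ U t) ^ 2 + lam * ∑ k, |x k|
      ≤ 1 / (2 * N) * ∑ t ∈ S, ((g ⬝ᵥ U t + e t) - g ⬝ᵥ U t) ^ 2 + lam * ∑ k, |g k|)
    (hcorr : ∀ k, |∑ t ∈ S, U t k * e t| ≤ lam / 2 * N) (hR : ∑ k, |g k| ≤ R)
    (hgram : ∀ k l, |∑ t ∈ S, U t k * U t l - (if k = l then σ2 * N else 0)| ≤ δ * σ2 * N) :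
    ∑ k, (g k - x k) ^ 2 ≤ 3 * lam * R / σ2 + 16 * R ^ 2 * δ := by
  set d : κ → ℝ := fun k => g k - x k with hd
  set P := ∑ t ∈ S, (d ⬝ᵥ U t) ^ 2 with hP
  set Q := ∑ t ∈ S, d ⬝ᵥ U t * e t with hQ
  set dn := ∑ k, |d k| with hdn
  set gn := ∑ k, |g k| with hgn
  set xn := ∑ k, |x k| with hxn
  have hdn0 : 0 ≤ dn := Finset.sum_nonneg fun _ _ => abs_nonneg _
  have hgn0 : 0 ≤ gn := Finset.sum_nonneg fun _ _ => abs_nonneg _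
  have hxn0 : 0 ≤ xn := Finset.sum_nonneg fun _ _ => abs_nonneg _
  have hP0 : 0 ≤ P := Finset.sum_nonneg fun _ _ => sq_nonneg _
  have htri : dn ≤ gn + xn := by
    rw [hdn, hgn, hxn, ← Finset.sum_add_distrib]
    exact Finset.sum_le_sum fun k _ => abs_sub _ _
  have hexp : ∑ t ∈ S, ((g ⬝ᵥ U t + e t) - x ⬝ᵥ U t) ^ 2
      = P + 2 * Q + ∑ t ∈ S, ((g ⬝ᵥ U t + e t) - g ⬝ᵥ U t) ^ 2 := by
    rw [hP, hQ, Finset.mul_sum, ← Finset.sum_add_distrib, ← Finset.sum_add_distrib]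
    refine Finset.sum_congr rfl fun t _ => ?_
    have : d ⬝ᵥ U t = g ⬝ᵥ U t - x ⬝ᵥ U t := sub_dotProduct g x (U t)
    rw [this]; ring
  have hQb : |Q| ≤ lam / 2 * N * dn := by
    have : Q = ∑ k, d k * ∑ t ∈ S, U t k * e t := by
      simp only [hQ, dotProduct, Finset.sum_mul, Finset.mul_sum]
      rw [Finset.sum_comm]
      simp only [mul_assoc]
    rw [this, hdn, Finset.mul_sum]
    refine (Finset.abs_sum_le_sum_abs _ _).trans (Finset.sum_le_sum fun k _ => ?_)
    rw [abs_mul, mul_comm]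
    exact mul_le_mul_of_nonneg_right (hcorr k) (abs_nonneg _)
  have hbasic : P ≤ N * lam * (3 * gn - xn) := by
    rw [hexp] at hmin
    have h1 : 1 / (2 * N) * (P + 2 * Q) ≤ lam * (gn - xn) := by
      rw [mul_add] at hmin; linarith
    rw [div_mul_eq_mul_div, one_mul, div_le_iff₀ (by positivity)] at h1
    have h2 := (abs_le.1 hQb).1
    have h3 : lam / 2 * N * dn ≤ lam / 2 * N * (gn + xn) := by gcongr
    linarith
  have hx3 : xn ≤ 3 * gn := by
    have : 0 ≤ 3 * gn - xn := by
      by_contra! h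
      have : N * lam * (3 * gn - xn) < 0 := mul_neg_of_pos_of_neg (by positivity) h
      linarith
    linarith
  have hPb : P ≤ N * (3 * lam * R) := by
    refine hbasic.trans ?_
    rw [mul_assoc]
    refine mul_le_mul_of_nonneg_left ?_ hN.le
    nlinarith
  have hdR : dn ≤ 4 * R := by linarith
  have hPG : P = ∑ k, ∑ l, d k * d l * ∑ t ∈ S, U t k * U t l := by
    have hsq : ∀ t, (d ⬝ᵥ U t) ^ 2 = ∑ k, ∑ l, d k * d l * (U t k * U t l) := fun t => by
      rw [sq, dotProduct, Finset.sum_mul_sum]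
      exact Finset.sum_congr rfl fun k _ => Finset.sum_congr rfl fun l _ => by ring
    simp only [hP, hsq, Finset.mul_sum]
    rw [Finset.sum_comm]
    exact Finset.sum_congr rfl fun k _ => Finset.sum_comm
  have hdiag : ∑ k, ∑ l, d k * d l * (if k = l then σ2 * N else 0) = σ2 * N * ∑ k, d k ^ 2 := by
    simp only [mul_ite, mul_zero, Finset.sum_ite_eq, Finset.mem_univ, if_true, Finset.mul_sum]
    exact Finset.sum_congr rfl fun k _ => by ring
  have hdev : |P - σ2 * N * ∑ k, d k ^ 2| ≤ δ * σ2 * N * dn ^ 2 := by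
    rw [← hdiag, hPG, ← Finset.sum_sub_distrib]
    simp only [← Finset.sum_sub_distrib, ← mul_sub]
    rw [sq, hdn, Finset.sum_mul_sum, Finset.mul_sum]
    refine (Finset.abs_sum_le_sum_abs _ _).trans (Finset.sum_le_sum fun k _ => ?_)
    rw [Finset.mul_sum]
    refine (Finset.abs_sum_le_sum_abs _ _).trans (Finset.sum_le_sum fun l _ => ?_)
    rw [abs_mul, abs_mul, mul_comm]
    exact mul_le_mul_of_nonneg_right (hgram k l) (by positivity)
  have h4 := (abs_le.1 hdev).1
  have h5 : δ * σ2 * N * dn ^ 2 ≤ δ * σ2 * N * (4 * R) ^ 2 := by gcongr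
  have h6 : σ2 * N * ∑ k, d k ^ 2 ≤ σ2 * N * (3 * lam * R / σ2 + 16 * R ^ 2 * δ) := by
    have : σ2 * N * (3 * lam * R / σ2 + 16 * R ^ 2 * δ)
        = N * (3 * lam * R) + δ * σ2 * N * (4 * R) ^ 2 := by field_simp; ring
    linarith
  exact le_of_mul_le_mul_left h6 (by positivity)

/-- The objective separates over the rows, so each row of a minimizer minimizes its own
objective. -/
lemma IsLassoEstimate.row {p m T N : ℕ} {lam : ℝ} {u : ℕ → Fin p → ℝ} {y : ℕ → Fin m → ℝ}
    {X : Matrix (Fin m) (Fin T × Fin p) ℝ} (h : IsLassoEstimate T N lam u y X) (i : Fin m)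
    (g : Fin T × Fin p → ℝ) :
    1 / (2 * (N : ℝ)) * ∑ t ∈ Finset.Ico (T - 1) (T - 1 + N), (y t i - X i ⬝ᵥ stackedInput T u t) ^ 2
        + lam * ∑ k, |X i k|
      ≤ 1 / (2 * (N : ℝ)) * ∑ t ∈ Finset.Ico (T - 1) (T - 1 + N),
          (y t i - g ⬝ᵥ stackedInput T u t) ^ 2 + lam * ∑ k, |g k| := by
  have hobj : ∀ Z : Matrix (Fin m) (Fin T × Fin p) ℝ, lassoObjective T N lam u y Z
      = ∑ j, (1 / (2 * (N : ℝ)) * ∑ t ∈ Finset.Ico (T - 1) (T - 1 + N),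
          (y t j - Z j ⬝ᵥ stackedInput T u t) ^ 2 + lam * ∑ k, |Z j k|) := by
    intro Z
    rw [lassoObjective, Finset.sum_comm, Finset.mul_sum, Finset.mul_sum, ← Finset.sum_add_distrib]
    rfl
  have h1 := h (Matrix.updateRow X i g)
  rw [hobj, hobj, ← Finset.add_sum_erase _ _ (Finset.mem_univ i),
    ← Finset.add_sum_erase _ _ (Finset.mem_univ i)] at h1
  have h2 : ∀ j ∈ Finset.univ.erase i, Matrix.updateRow X i g j = X j := fun j hj =>
    Matrix.updateRow_ne (Finset.ne_of_mem_erase hj)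
  have h3 : ∀ F : (Fin m) → (Fin T × Fin p → ℝ) → ℝ,
      ∑ j ∈ Finset.univ.erase i, F j (Matrix.updateRow X i g j)
        = ∑ j ∈ Finset.univ.erase i, F j (X j) := fun F =>
    Finset.sum_congr rfl fun j hj => by rw [h2 j hj]
  rw [h3 fun j z => 1 / (2 * (N : ℝ)) * ∑ t ∈ Finset.Ico (T - 1) (T - 1 + N),
    (y t j - z ⬝ᵥ stackedInput T u t) ^ 2 + lam * ∑ k, |z k|] at h1
  simpa [Matrix.updateRow_self] using le_of_add_le_add_right h1

end Lasso

/-! ### Norms of a matrix with controlled rows -/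

lemma twoInfNorm_le {ι κ : Type*} [Nonempty ι] [Fintype κ] {M : Matrix ι κ ℝ} {b : ℝ}
    (hb : 0 ≤ b) (h : ∀ i, ∑ j, M i j ^ 2 ≤ b ^ 2) : twoInfNorm M ≤ b :=
  ciSup_le fun i => (Real.sqrt_le_sqrt (h i)).trans_eq (Real.sqrt_sq hb)

lemma frobNorm_le {ι κ : Type*} [Fintype ι] [Fintype κ] {M : Matrix ι κ ℝ} {b : ℝ}
    (hb : 0 ≤ b) (h : ∀ i, ∑ j, M i j ^ 2 ≤ b ^ 2) :
    frobNorm M ≤ √(Fintype.card ι : ℝ) * b := by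
  have hsq : √(Fintype.card ι : ℝ) * b = √((Fintype.card ι : ℝ) * b ^ 2) := by
    rw [Real.sqrt_mul (by positivity), Real.sqrt_sq hb]
  refine (Real.sqrt_le_sqrt ((Finset.sum_le_sum fun i _ => h i).trans_eq ?_)).trans_eq hsq.symm
  rw [Finset.sum_const, nsmul_eq_mul, Finset.card_univ]

/-! ### Concentration of the empirical second moments and correlations -/

section Concentration

variable {Ω : Type*} [MeasurableSpace Ω] {μ : Measure Ω}

lemma hasSubgaussianMGF_of_hasLaw_gaussianReal {X : Ω → ℝ} {c : ℝ≥0}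
    (h : HasLaw X (gaussianReal 0 c) μ) : HasSubgaussianMGF X c μ := by
  have : NeZero μ := ⟨by
    rintro rfl
    have := h.map_eq
    simp only [Measure.map_zero] at this
    exact (NeZero.ne (gaussianReal 0 c)) this.symm⟩
  refine ⟨fun t => ?_, fun t => ?_⟩
  · rw [← mgf_pos_iff, mgf_gaussianReal h.map_eq]
    exact Real.exp_pos _
  · rw [mgf_gaussianReal h.map_eq, zero_mul, zero_add]

lemma hasSubgaussianMGF_mono {X : Ω → ℝ} {c d : ℝ≥0} (h : HasSubgaussianMGF X c μ)
    (hcd : c ≤ d) : HasSubgaussianMGF X d μ :=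
  ⟨h.integrable_exp_mul, fun t => (h.mgf_le t).trans (Real.exp_le_exp.2 (by gcongr))⟩

variable {n p m T N : ℕ} {u : ℕ → Ω → Fin p → ℝ} {w : ℕ → Ω → Fin n → ℝ} {v : ℕ → Ω → Fin m → ℝ}

lemma measurable_source
    (hm : ∀ t < T + N - 1, Measurable (u t) ∧ Measurable (w t) ∧ Measurable (v t)) :
    ∀ t < T + N - 1, ∀ α, Measurable (source u w v t α) := by
  intro t ht α
  obtain ⟨h1, h2, h3⟩ := hm t ht
  rcases α with j | j | j
  · exact (measurable_pi_apply j).comp h1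
  · exact (measurable_pi_apply j).comp h2
  · exact (measurable_pi_apply j).comp h3

/-- The empirical second moments of the stacked inputs are entrywise close to those of white
noise. -/
lemma measure_gram_lt_le [IsProbabilityMeasure μ]
    (hm : ∀ t < T + N - 1, ∀ α, Measurable (source u w v t α))
    (hind : iIndepFun (fun k : Fin (T + N - 1) × (Fin p ⊕ Fin n ⊕ Fin m) =>
      source u w v k.1 k.2) μ)
    {σu : ℝ≥0} (hσu : 0 < σu)
    (hu : ∀ t < T + N - 1, ∀ j, HasLaw (source u w v t (.inl j)) (gaussianReal 0 (σu ^ 2)) μ)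
    (hT : 1 ≤ T) (hN : 1 ≤ N) {L : ℝ} (hL : 0 ≤ L) (hLN : 16 * L ≤ N) (c : ℝ)
    (k l : Fin T × Fin p) :
    μ {ω | c * ((σu : ℝ) * σu) * √(L / N) * N <
        |∑ t ∈ Finset.Ico (T - 1) (T - 1 + N),
          stackedInput T (fun t => u t ω) t k * stackedInput T (fun t => u t ω) t l
          - (if k = l then (σu : ℝ) ^ 2 * N else 0)|}
      ≤ ENNReal.ofReal (2 * Real.exp (-((c - 4) * L))) := by
  have hN0 : (0 : ℝ) < N := by exact_mod_cast hN
  have hσ0 : (0 : ℝ) < σu := by exact_mod_cast hσu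
  have hS : ∀ k : Fin T, ∀ t ∈ Finset.Ico (T - 1) (T - 1 + N), t < T + N - 1 ∧ (k : ℕ) ≤ t := by
    intro k t ht
    have := k.2
    rw [Finset.mem_Ico] at ht
    omega
  have hmeas := measurable_sum_lag_mul hm (.inl l.2) (.inl k.2) (k := k.1) (r := l.1)
    (Finset.Ico (T - 1) (T - 1 + N)) fun t ht => (hS k.1 t ht).1
  rcases eq_or_ne k l with rfl | hkl
  · have h := hasSubexpMGF_sum_lag_sq_sub hm hind hσu.ne' (fun t ht => hu t ht k.2)
      (k := k.1) (Finset.Ico (T - 1) (T - 1 + N)) (hS k.1)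
    rw [Nat.card_Ico, Nat.add_sub_cancel_left] at h
    simp only [Finset.sum_sub_distrib, Finset.sum_const, Nat.card_Ico, Nat.add_sub_cancel_left,
      nsmul_eq_mul, mul_comm (N : ℝ) ((σu : ℝ) ^ 2)] at h
    simpa only [if_true, stackedInput, source] using h.measure_lt_abs_le (hmeas.sub_const _).aemeasurable
      (by positivity) hL hN0 hLN c
  · have h := hasSubexpMGF_sum_lag_mul hm hind hσu.ne' (fun t ht => hu t ht k.2)
      (fun t ht => hasSubgaussianMGF_of_hasLaw_gaussianReal (hu t ht l.2)) (k := k.1) (r := l.1)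
      (Finset.Ico (T - 1) (T - 1 + N))
      (fun t ht => ⟨(hS k.1 t ht).1, (hS k.1 t ht).2, (hS l.1 t ht).2⟩)
      (fun h1 h2 => hkl (Prod.ext (Fin.ext h1) (Sum.inl_injective h2)))
      (N := N) (by simp)
    simpa only [hkl, if_false, sub_zero, stackedInput, source] using h.measure_lt_abs_le hmeas.aemeasurable
      (by positivity) hL hN0 hLN c

/-- The stacked inputs are nearly uncorrelated with the regression noise. -/
lemma measure_corr_lt_le [IsProbabilityMeasure μ]
    (hm : ∀ t < T + N - 1, ∀ α, Measurable (source u w v t α))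
    (hind : iIndepFun (fun k : Fin (T + N - 1) × (Fin p ⊕ Fin n ⊕ Fin m) =>
      source u w v k.1 k.2) μ)
    {σu σw σv : ℝ≥0} (hσu : 0 < σu) (hσw : 0 < σw) (hσv : 0 < σv)
    (hu : ∀ t < T + N - 1, ∀ j, HasLaw (source u w v t (.inl j)) (gaussianReal 0 (σu ^ 2)) μ)
    (hsub : ∀ t < T + N - 1, ∀ α,
      HasSubgaussianMGF (source u w v t α) (sourceScale σu σw σv α ^ 2) μ)
    (hT : 1 ≤ T) (hN : 1 ≤ N) {L : ℝ} (hL : 0 ≤ L) (hLN : 16 * L ≤ N) (c : ℝ)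
    {A : Matrix (Fin n) (Fin n) ℝ} {B : Matrix (Fin n) (Fin p) ℝ} {C : Matrix (Fin m) (Fin n) ℝ}
    (i : Fin m) {q : ℝ}
    (hq : ∑ r ∈ Finset.range (T + N - 1), ∑ α, |noiseCoeff A B C T i r α|
      * sourceScale σu σw σv α ≤ q) (hq0 : 0 < q) (k : Fin T × Fin p) :
    μ {ω | c * (σu * q) * √(L / N) * N <
        |∑ t ∈ Finset.Ico (T - 1) (T - 1 + N), stackedInput T (fun t => u t ω) t k *
          ∑ r ∈ Finset.range (t + 1), ∑ α, noiseCoeff A B C T i r α * source u w v (t - r) α ω|}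
      ≤ ENNReal.ofReal (2 * Real.exp (-((c - 4) * L))) := by
  have hN0 : (0 : ℝ) < N := by exact_mod_cast hN
  have hσ0 : (0 : ℝ) < σu := by exact_mod_cast hσu
  set S := Finset.Ico (T - 1) (T - 1 + N) with hSdef
  have hS : ∀ t ∈ S, t < T + N - 1 ∧ (k.1 : ℕ) ≤ t := by
    intro t ht
    have := k.1.2
    rw [hSdef, Finset.mem_Ico] at ht
    omega
  set Z : ℕ × (Fin p ⊕ Fin n ⊕ Fin m) → Ω → ℝ := fun x ω =>
    ∑ t ∈ S with x.1 ≤ t, source u w v (t - k.1) (.inl k.2) ω * source u w v (t - x.1) x.2 ω with hZ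
  set I := Finset.range (T + N - 1) ×ˢ (Finset.univ : Finset (Fin p ⊕ Fin n ⊕ Fin m)) with hI
  have hscale : ∀ α : Fin p ⊕ Fin n ⊕ Fin m, (0 : ℝ) < sourceScale σu σw σv α := by
    intro α
    rcases α with j | j | j
    · exact hσ0
    · exact_mod_cast hσw
    · exact_mod_cast hσv
  have hZm : ∀ x, Measurable (Z x) := fun x =>
    measurable_sum_lag_mul hm _ _ _ fun t ht => (hS t (Finset.mem_filter.1 ht).1).1
  have heq : ∀ ω, ∑ t ∈ S, stackedInput T (fun t => u t ω) t k *
        ∑ r ∈ Finset.range (t + 1), ∑ α, noiseCoeff A B C T i r α * source u w v (t - r) α ω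
      = ∑ x ∈ I, noiseCoeff A B C T i x.1 x.2 * Z x ω := by
    intro ω
    have h1 : ∀ t ∈ S, stackedInput T (fun t => u t ω) t k *
        ∑ r ∈ Finset.range (t + 1), ∑ α, noiseCoeff A B C T i r α * source u w v (t - r) α ω
        = ∑ r ∈ Finset.range (T + N - 1), ∑ α, if r ≤ t then noiseCoeff A B C T i r α *
          (source u w v (t - k.1) (.inl k.2) ω * source u w v (t - r) α ω) else 0 := by
      intro t ht
      have hsub' : Finset.range (t + 1) ⊆ Finset.range (T + N - 1) :=
        Finset.range_subset_range.2 (hS t ht).1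
      rw [Finset.mul_sum, ← Finset.sum_subset hsub']
      · refine Finset.sum_congr rfl fun r hr => ?_
        rw [Finset.mul_sum]
        refine Finset.sum_congr rfl fun α _ => ?_
        rw [if_pos (Nat.lt_succ_iff.1 (Finset.mem_range.1 hr))]
        simp only [stackedInput, source]
        ring
      · intro r _ hr
        have : ¬ r ≤ t := fun h => hr (Finset.mem_range.2 (Nat.lt_succ_of_le h))
        simp [this]
    rw [Finset.sum_congr rfl h1, hI, Finset.sum_product, Finset.sum_comm]
    refine Finset.sum_congr rfl fun r _ => ?_
    rw [Finset.sum_comm]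
    refine Finset.sum_congr rfl fun α _ => ?_
    simp only [hZ]
    rw [Finset.sum_filter, Finset.mul_sum]
    exact Finset.sum_congr rfl fun t _ => by split_ifs <;> simp
  simp only [heq]
  refine HasSubexpMGF.measure_lt_abs_le (HasSubexpMGF.sum I (fun x => noiseCoeff A B C T i x.1 x.2)
    (fun x => σu * sourceScale σu σw σv x.2) Z hN0.le (by positivity)
    (fun x _ => mul_pos hσ0 (hscale x.2)) (fun x _ => (hZm x).aemeasurable) ?_ ?_)
    (Finset.measurable_sum _ fun x _ => (hZm x).const_mul _).aemeasurable (by positivity)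
    hL hN0 hLN c
  · rintro ⟨r, α⟩ _ hne
    refine hasSubexpMGF_sum_lag_mul hm hind hσu.ne' (fun t ht => hu t ht k.2)
      (fun t ht => hsub t ht α) _ (fun t ht => ?_) ?_ ?_
    · have h1 := Finset.mem_filter.1 ht
      exact ⟨(hS t h1.1).1, (hS t h1.1).2, h1.2⟩
    · -- An input enters the noise at lags `r ≥ T` only, beyond those of the regressor.
      rintro hkr rfl
      have hk := k.1.2
      refine hne ?_
      have : ¬ T ≤ r := by omega
      simp [noiseCoeff, this]
    · refine le_trans (Nat.cast_le.2 (Finset.card_filter_le _ _)) ?_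
      simp [hSdef]
  · rw [hI, Finset.sum_product]
    calc _ = σu * ∑ r ∈ Finset.range (T + N - 1), ∑ α, |noiseCoeff A B C T i r α|
          * sourceScale σu σw σv α := by
          simp only [Finset.mul_sum]
          exact Finset.sum_congr rfl fun r _ => Finset.sum_congr rfl fun α _ => by ring
      _ ≤ σu * q := by gcongr

end Concentration

/-! ### Scales and constants -/

/-- The squared error produced by the lasso bound is dominated by the two error terms. -/
lemma lasso_error_le {n p T N : ℕ} {Csys ρ σu σw σv ε lam c c₂ : ℝ} (h1 : 1 ≤ Csys)
    (hρ1 : ρ < 1) (hσu : 0 < σu) (hσu2 : σu ≤ 2) (hσw : 0 ≤ σw) (hσv : 0 ≤ σv) (hε : 0 < ε)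
    (hc : 0 ≤ c) (hc₂ : 0 ≤ c₂) (hL : 0 ≤ Real.log ((T : ℝ) * p))
    (hℓ : 0 ≤ Real.log ((T : ℝ) * p * n))
    (hlam : lam ≤ c₂ * lambdaScale n p T N Csys ρ σu σw σv ε) :
    3 * lam * (2 * (Csys ^ 3 / (1 - ρ))) / σu ^ 2
        + 16 * (2 * (Csys ^ 3 / (1 - ρ))) ^ 2 * (c * √(Real.log ((T : ℝ) * p) / N))
      ≤ (√(24 * c₂ + 64 * c) *
          max (errOne n p T N Csys ρ σu σw σv ε) (errTwo p T N Csys ρ)) ^ 2 := by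
  have h1ρ : 0 < 1 - ρ := by linarith
  have hC0 : 0 < Csys := by linarith
  set κ := Csys ^ 3 / (1 - ρ) with hκ
  have hκ0 : 0 < κ := by positivity
  set q := effSigma Csys ρ σw + σv with hq
  have hq0 : 0 ≤ q := by rw [hq, effSigma]; positivity
  set a := Real.log ((T : ℝ) * p * n) / N with ha
  have ha0 : 0 ≤ a := by positivity
  set b := Real.log ((T : ℝ) * p) / N with hb
  have hb0 : 0 ≤ b := by positivity
  have hquart : ∀ x : ℝ, 0 ≤ x → (x ^ ((1 : ℝ) / 4)) ^ 2 = √x := fun x hx => by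
    rw [Real.sqrt_eq_rpow, ← Real.rpow_natCast, ← Real.rpow_mul hx]
    norm_num
  have hE1 : κ * (q / σu ^ 3 * √a + ε / σu ^ 4) ≤ errOne n p T N Csys ρ σu σw σv ε ^ 2 := by
    rw [errOne, ← hκ, ← hq, ← ha, mul_pow, Real.sq_sqrt hκ0.le]
    gcongr
    rw [add_sq, mul_pow, hquart a ha0, Real.sq_sqrt (by positivity), div_pow, Real.sq_sqrt hε.le,
      ← pow_mul]
    have : 0 ≤ 2 * (√(q / σu ^ 3) * a ^ ((1 : ℝ) / 4)) * (√ε / σu ^ 2) := by positivity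
    linarith
  have hE2 : κ ^ 2 * √b = errTwo p T N Csys ρ ^ 2 := by
    rw [errTwo, ← hκ, ← hb, mul_pow, hquart b hb0]
  set M := max (errOne n p T N Csys ρ σu σw σv ε) (errTwo p T N Csys ρ) with hM
  have hE10 : 0 ≤ errOne n p T N Csys ρ σu σw σv ε := by
    rw [errOne, ← ha]; positivity
  have hE20 : 0 ≤ errTwo p T N Csys ρ := by rw [errTwo, ← hκ, ← hb]; positivity
  have hM1 : errOne n p T N Csys ρ σu σw σv ε ^ 2 ≤ M ^ 2 := by
    gcongr; exact le_max_left _ _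
  have hM2 : errTwo p T N Csys ρ ^ 2 ≤ M ^ 2 := by
    gcongr; exact le_max_right _ _
  rw [mul_pow (√_), Real.sq_sqrt (by positivity)]
  have hs4 : 1 ≤ 4 / σu ^ 2 := by
    rw [le_div_iff₀ (by positivity)]; nlinarith
  have hfirst : 3 * lam * (2 * κ) / σu ^ 2 ≤ 24 * c₂ * M ^ 2 := by
    calc 3 * lam * (2 * κ) / σu ^ 2 ≤ 3 * (c₂ * (σu * q * √a + ε)) * (2 * κ) / σu ^ 2 := by
          gcongr; exact hlam
      _ = 6 * c₂ * κ * (q / σu * √a + ε / σu ^ 2) * 1 := by field_simp; ring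
      _ ≤ 6 * c₂ * κ * (q / σu * √a + ε / σu ^ 2) * (4 / σu ^ 2) := by gcongr
      _ = 24 * c₂ * (κ * (q / σu ^ 3 * √a + ε / σu ^ 4)) := by field_simp; ring
      _ ≤ 24 * c₂ * M ^ 2 := by gcongr; exact hE1.trans hM1
  have hsecond : 16 * (2 * κ) ^ 2 * (c * √b) ≤ 64 * c * M ^ 2 := by
    calc 16 * (2 * κ) ^ 2 * (c * √b) = 64 * c * (κ ^ 2 * √b) := by ring
      _ ≤ 64 * c * M ^ 2 := by gcongr; exact hE2.trans_le hM2
  linarith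

/-- The union bound over the second moments and the correlations. -/
lemma union_bound_le {D M η : ℝ} (hD : 2 ≤ D) (hM : 1 ≤ M) :
    (D * D + M * D) * (2 * Real.exp (-((η + 8 - 4) * Real.log D))) ≤ M * D ^ (-η) := by
  have hD0 : 0 < D := by linarith
  have h1 : Real.exp (-((η + 8 - 4) * Real.log D)) = D ^ (-η) * (D ^ 4)⁻¹ := by
    rw [← Real.rpow_natCast D 4, ← Real.rpow_neg hD0.le, ← Real.rpow_add hD0,
      Real.rpow_def_of_pos hD0]
    congr 1
    push_cast
    ring
  rw [h1]
  have h2 : (D * D + M * D) * 2 ≤ M * D ^ 4 := by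
    have h3 : D * D + M * D ≤ 2 * (M * D ^ 2) := by
      have h5 : D ≤ D ^ 2 := by nlinarith
      have h6 : D * D ≤ M * D ^ 2 := by nlinarith [sq_nonneg D]
      have h7 : M * D ≤ M * D ^ 2 := by gcongr
      linarith
    have h4 : 4 * D ^ 2 ≤ D ^ 4 := by
      have h5 : 4 ≤ D ^ 2 := by nlinarith
      calc 4 * D ^ 2 ≤ D ^ 2 * D ^ 2 := by gcongr
        _ = D ^ 4 := by ring
    have h8 : M * (4 * D ^ 2) ≤ M * D ^ 4 := by gcongr
    linarith
  calc (D * D + M * D) * (2 * (D ^ (-η) * (D ^ 4)⁻¹))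
      = (D * D + M * D) * 2 * (D ^ 4)⁻¹ * D ^ (-η) := by ring
    _ ≤ M * D ^ 4 * (D ^ 4)⁻¹ * D ^ (-η) := by gcongr
    _ = M * D ^ (-η) := by field_simp

/-! ### The estimation error -/

/-- On the event that the second moments and the correlations are under control, every row of the
estimate is accurate. -/
lemma row_error_le {n p m T N : ℕ} {A : Matrix (Fin n) (Fin n) ℝ} {B : Matrix (Fin n) (Fin p) ℝ}
    {C : Matrix (Fin m) (Fin n) ℝ} {D : Matrix (Fin m) (Fin p) ℝ} {Csys ρ : ℝ} (h1 : 1 ≤ Csys)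
    (hρ0 : 0 ≤ ρ) (hρ1 : ρ < 1) (hA : ∀ τ : ℕ, rowL1Norm (A ^ τ) ≤ Csys * ρ ^ τ)
    (hB : rowL1Norm B ≤ Csys) (hC : rowL1Norm C ≤ Csys) (hD : rowL1Norm D ≤ Csys)
    (hT : 1 ≤ T) (hN : 1 ≤ N) {Ω : Type*} {u : ℕ → Ω → Fin p → ℝ} {w : ℕ → Ω → Fin n → ℝ}
    {v : ℕ → Ω → Fin m → ℝ} {ω : Ω} {lam σ δ : ℝ} (hlam : 0 < lam) (hσ : 0 < σ) (hδ : 0 ≤ δ)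
    {X : Matrix (Fin m) (Fin T × Fin p) ℝ}
    (hX : IsLassoEstimate T N lam (fun t => u t ω)
      (output A B C D (fun t => u t ω) (fun t => w t ω) (fun t => v t ω)) X)
    (i : Fin m)
    (hcorr : ∀ k, |∑ t ∈ Finset.Ico (T - 1) (T - 1 + N), stackedInput T (fun t => u t ω) t k *
      ∑ r ∈ Finset.range (t + 1), ∑ α, noiseCoeff A B C T i r α * source u w v (t - r) α ω|
      ≤ lam / 2 * N)
    (hgram : ∀ k l, |∑ t ∈ Finset.Ico (T - 1) (T - 1 + N),
        stackedInput T (fun t => u t ω) t k * stackedInput T (fun t => u t ω) t l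
        - (if k = l then σ ^ 2 * N else 0)| ≤ δ * σ ^ 2 * N) :
    ∑ k, (markovMatrix A B C D T - X) i k ^ 2
      ≤ 3 * lam * (2 * (Csys ^ 3 / (1 - ρ))) / σ ^ 2
        + 16 * (2 * (Csys ^ 3 / (1 - ρ))) ^ 2 * δ := by
  have hrow := hX.row i (markovMatrix A B C D T i)
  have hs : ∀ z : Fin T × Fin p → ℝ, ∑ t ∈ Finset.Ico (T - 1) (T - 1 + N),
        (output A B C D (fun t => u t ω) (fun t => w t ω) (fun t => v t ω) t i
          - z ⬝ᵥ stackedInput T (fun t => u t ω) t) ^ 2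
      = ∑ t ∈ Finset.Ico (T - 1) (T - 1 + N),
        ((markovMatrix A B C D T i ⬝ᵥ stackedInput T (fun t => u t ω) t
          + ∑ r ∈ Finset.range (t + 1), ∑ α, noiseCoeff A B C T i r α * source u w v (t - r) α ω)
          - z ⬝ᵥ stackedInput T (fun t => u t ω) t) ^ 2 := fun z =>
    Finset.sum_congr rfl fun t ht => by
      rw [output_eq_markovMatrix_mulVec_add A B C D u w v ω hT (Finset.mem_Ico.1 ht).1 i]
      rfl
  rw [hs, hs] at hrow
  exact sum_sq_sub_le_of_lasso _ _ _ _ _ (by exact_mod_cast hN) hlam hδ (by positivity) hrow hcorr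
    (sum_abs_markovMatrix_le h1 hρ0 hρ1 hA hB hC hD T i) hgram

/-- With probability at least `1 - m D ^ (-η)`, where `D = T p`, all empirical second moments and
all correlations with the noise are small. -/
lemma measure_not_good_le {n p m T N : ℕ} {Ω : Type*} [MeasurableSpace Ω] {μ : Measure Ω}
    [IsProbabilityMeasure μ] {u : ℕ → Ω → Fin p → ℝ} {w : ℕ → Ω → Fin n → ℝ}
    {v : ℕ → Ω → Fin m → ℝ}
    (hm : ∀ t < T + N - 1, ∀ α, Measurable (source u w v t α))
    (hind : iIndepFun (fun k : Fin (T + N - 1) × (Fin p ⊕ Fin n ⊕ Fin m) =>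
      source u w v k.1 k.2) μ)
    {σu σw σv : ℝ≥0} (hσu : 0 < σu) (hσw : 0 < σw) (hσv : 0 < σv)
    (hu : ∀ t < T + N - 1, ∀ j, HasLaw (source u w v t (.inl j)) (gaussianReal 0 (σu ^ 2)) μ)
    (hsub : ∀ t < T + N - 1, ∀ α,
      HasSubgaussianMGF (source u w v t α) (sourceScale σu σw σv α ^ 2) μ)
    (hT : 1 ≤ T) (hN : 1 ≤ N) (hm1 : 1 ≤ m) {η : ℝ} (hD : 2 ≤ (T : ℝ) * p)
    (hLN : 16 * Real.log ((T : ℝ) * p) ≤ N)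
    {A : Matrix (Fin n) (Fin n) ℝ} {B : Matrix (Fin n) (Fin p) ℝ} {C : Matrix (Fin m) (Fin n) ℝ}
    {q : ℝ} (hq : ∀ i, ∑ r ∈ Finset.range (T + N - 1), ∑ α, |noiseCoeff A B C T i r α|
      * sourceScale σu σw σv α ≤ q) (hq0 : 0 < q) {bad : Set Ω}
    (hbad : ∀ ω,
      (∀ k l, |∑ t ∈ Finset.Ico (T - 1) (T - 1 + N),
          stackedInput T (fun t => u t ω) t k * stackedInput T (fun t => u t ω) t l
          - (if k = l then (σu : ℝ) ^ 2 * N else 0)|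
        ≤ (η + 8) * ((σu : ℝ) * σu) * √(Real.log ((T : ℝ) * p) / N) * N) →
      (∀ i k, |∑ t ∈ Finset.Ico (T - 1) (T - 1 + N), stackedInput T (fun t => u t ω) t k *
          ∑ r ∈ Finset.range (t + 1), ∑ α, noiseCoeff A B C T i r α * source u w v (t - r) α ω|
        ≤ (η + 8) * (σu * q) * √(Real.log ((T : ℝ) * p) / N) * N) → ω ∉ bad) :
    μ bad ≤ ENNReal.ofReal ((m : ℝ) * ((T : ℝ) * p) ^ (-η)) := by
  have hL : 0 ≤ Real.log ((T : ℝ) * p) := Real.log_nonneg (by linarith)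
  set E := 2 * Real.exp (-((η + 8 - 4) * Real.log ((T : ℝ) * p))) with hE
  have hE0 : 0 ≤ E := by positivity
  have hgr := measure_gram_lt_le hm hind hσu hu hT hN hL hLN (η + 8)
  have hco := fun i k => measure_corr_lt_le hm hind hσu hσw hσv hu hsub hT hN hL hLN (η + 8) i
    (hq i) hq0 k
  refine (measure_mono fun ω hω => ?_).trans ((measure_union_le (⋃ k, ⋃ l, _)
    (⋃ i, ⋃ k, _)).trans ((add_le_add
      ((measure_iUnion_fintype_le μ _).trans (Finset.sum_le_sum fun k _ =>
        (measure_iUnion_fintype_le μ _).trans (Finset.sum_le_sum fun l _ => hgr k l)))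
      ((measure_iUnion_fintype_le μ _).trans (Finset.sum_le_sum fun i _ =>
        (measure_iUnion_fintype_le μ _).trans (Finset.sum_le_sum fun k _ => hco i k)))).trans ?_))
  · by_contra hnot
    simp only [Set.mem_union, Set.mem_iUnion, Set.mem_ofPred_eq, not_or, not_exists, not_lt] at hnot
    exact hbad ω hnot.1 hnot.2 hω
  · simp only [Finset.sum_const, Finset.card_univ, Fintype.card_prod, Fintype.card_fin,
      nsmul_eq_mul]
    rw [← ENNReal.ofReal_natCast, ← ENNReal.ofReal_natCast, ← ENNReal.ofReal_mul (by positivity),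
      ← ENNReal.ofReal_mul (by positivity), ← ENNReal.ofReal_mul (by positivity),
      ← ENNReal.ofReal_add (by positivity) (by positivity)]
    refine ENNReal.ofReal_le_ofReal (le_trans (le_of_eq ?_)
      (union_bound_le (η := η) hD (by exact_mod_cast hm1 : (1 : ℝ) ≤ m)))
    push_cast
    ring

end LTI

theorem mainTheorem1 :
    -- `K`, `c₁` depend on `η` only, and `Cst` on `η` and `c₂` only
    ∀ η : ℝ, 0 < η → ∃ K > (0 : ℝ), ∃ c₁ > (0 : ℝ), ∀ c₂ ≥ c₁, ∃ Cst > (0 : ℝ),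
    ∀ (n p m T N : ℕ), 1 ≤ n → 1 ≤ p → 1 ≤ m → 1 ≤ T → 1 ≤ N →
    -- the system and its stability constants
    ∀ (A : Matrix (Fin n) (Fin n) ℝ) (B : Matrix (Fin n) (Fin p) ℝ)
      (C : Matrix (Fin m) (Fin n) ℝ) (D : Matrix (Fin m) (Fin p) ℝ)
      (Csys ρ : ℝ), 1 ≤ Csys → 0 ≤ ρ → ρ < 1 →
      (∀ τ : ℕ, LTI.rowL1Norm (A ^ τ) ≤ Csys * ρ ^ τ) →
      LTI.rowL1Norm B ≤ Csys → LTI.rowL1Norm C ≤ Csys → LTI.rowL1Norm D ≤ Csys →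
    -- the inputs and the noises
    ∀ (σu σw σv : ℝ≥0), 0 < σu → σu ≤ 2 →
    ∀ (Ω : Type*) [MeasurableSpace Ω] (μ : Measure Ω) [IsProbabilityMeasure μ]
      (u : ℕ → Ω → Fin p → ℝ) (w : ℕ → Ω → Fin n → ℝ) (v : ℕ → Ω → Fin m → ℝ),
      (∀ t < T + N - 1, Measurable (u t) ∧ Measurable (w t) ∧ Measurable (v t)) →
      iIndepFun (fun k : Fin (T + N - 1) × (Fin p ⊕ Fin n ⊕ Fin m) =>
        LTI.source u w v k.1 k.2) μ →
      (∀ t < T + N - 1, ∀ j, HasLaw (fun ω => u t ω j) (gaussianReal 0 (σu ^ 2)) μ) →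
      (∀ t < T + N - 1, ∀ j, HasSubgaussianMGF (fun ω => w t ω j) (σw ^ 2) μ) →
      (∀ t < T + N - 1, ∀ j, HasSubgaussianMGF (fun ω => v t ω j) (σv ^ 2) μ) →
    -- sample size, regressor length and regularization parameter
    ∀ (ε lam : ℝ), 0 < ε →
      K * Real.log ((T : ℝ) * p) ^ 2 ≤ N →
      K * LTI.horizonThreshold n p T N Csys ρ σu σw ε ≤ T →
      c₁ * LTI.lambdaScale n p T N Csys ρ σu σw σv ε ≤ lam →
      lam ≤ c₂ * LTI.lambdaScale n p T N Csys ρ σu σw σv ε →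
    -- the estimate
    ∀ Ghat : Ω → Matrix (Fin m) (Fin T × Fin p) ℝ,
      (∀ ω, LTI.IsLassoEstimate T N lam (fun t => u t ω)
        (LTI.output A B C D (fun t => u t ω) (fun t => w t ω) (fun t => v t ω)) (Ghat ω)) →
    -- both bounds fail with (outer) probability at most `m (Tp)^{-η}`
    μ {ω | ¬ (LTI.twoInfNorm (LTI.markovMatrix A B C D T - Ghat ω)
              ≤ Cst * max (LTI.errOne n p T N Csys ρ σu σw σv ε) (LTI.errTwo p T N Csys ρ) ∧
            LTI.frobNorm (LTI.markovMatrix A B C D T - Ghat ω)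
              ≤ Cst * (√(m : ℝ) *
                max (LTI.errOne n p T N Csys ρ σu σw σv ε) (LTI.errTwo p T N Csys ρ)))}
      ≤ ENNReal.ofReal ((m : ℝ) * ((T : ℝ) * p) ^ (-η)) := by
  intro η hη
  have hc0 : 0 < η + 8 := by linarith
  -- A deviation of `η + 8` scales has probability of order `(T p) ^ (-(η + 4))`, which leaves room
  -- for the union bound; `32` forces `16 log (T p) ≤ N`, as `log 2 > 1 / 2`.
  refine ⟨32, by norm_num, 6 * (η + 8), by positivity, fun c₂ hc₂ =>
    ⟨√(24 * c₂ + 64 * (η + 8)), ?_, ?_⟩⟩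
  · have : 0 < c₂ := lt_of_lt_of_le (by positivity) hc₂
    positivity
  intro n p m T N hn hp hm hT hN A B C D Csys ρ h1 hρ0 hρ1 hA hB hC hD σu σw σv hσu hσu2 Ω _ μ _
    u w v hmeas hind hu hw hv ε lam hε hNK hTK hlam1 hlam2 Ghat hmin
  have hm' : (1 : ℝ) ≤ m := by exact_mod_cast hm
  have hn' : (1 : ℝ) ≤ n := by exact_mod_cast hn
  have hN' : (0 : ℝ) < N := by exact_mod_cast hN
  -- For `T p = 1` the claimed bound on the probability is at least one.
  rcases lt_or_ge (T * p) 2 with hTp | hTp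
  · have hTp1 : (T : ℝ) * p = 1 := by
      have : 1 ≤ T * p := Nat.mul_pos hT hp
      exact_mod_cast (show T * p = 1 by omega)
    refine prob_le_one.trans ?_
    rw [hTp1, Real.one_rpow, mul_one]
    exact ENNReal.one_le_ofReal.2 hm'
  have hD2 : (2 : ℝ) ≤ (T : ℝ) * p := by exact_mod_cast hTp
  set L := Real.log ((T : ℝ) * p) with hLdef
  have hL2 : 1 / 2 ≤ L := by
    have := Real.log_le_log (by norm_num) hD2
    linarith [Real.log_two_gt_d9]
  have hLN : 16 * L ≤ N := by nlinarith
  have hN8 : (8 : ℝ) ≤ N := by nlinarith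
  have hbig10 : (10 : ℝ) ≤ (N : ℝ) * n + (T : ℝ) * p := by nlinarith
  have hexp1 : Real.exp 1 ≤ (N : ℝ) * n + (T : ℝ) * p := by
    linarith [Real.exp_one_lt_d9]
  have h1ρ : 0 < 1 - ρ := by linarith
  have hσu0 : (0 : ℝ) < σu := by exact_mod_cast hσu
  have hσu2' : (σu : ℝ) ≤ 2 := by exact_mod_cast hσu2
  have hσw0 : (0 : ℝ) ≤ σw := σw.2
  have hσv0 : (0 : ℝ) ≤ σv := σv.2
  have hT2 : 2 ≤ T := LTI.two_le_of_horizonThreshold_le h1 hρ0 hρ1 hbig10 hTK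
  have htrunc := LTI.truncation_le h1 hρ0 hρ1 hσu0 hσw0 hε (by norm_num) hexp1 hT2 hTK
  -- The noise parameters are enlarged so as to be positive, at a cost of at most `ε / 2`.
  set κ := Csys ^ 2 / (1 - ρ) + 1 with hκ
  have hκ0 : 0 < κ := by positivity
  obtain ⟨ε', hε', hε'eq⟩ : ∃ ε' : ℝ≥0, 0 < ε' ∧ κ * (ε' : ℝ) * 2 = ε :=
    ⟨⟨ε / (κ * 2), by positivity⟩, by
      show 0 < ε / (κ * 2)
      positivity, by
      show κ * (ε / (κ * 2)) * 2 = ε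
      field_simp⟩
  have hLn : L ≤ Real.log ((T : ℝ) * p * n) :=
    Real.log_le_log (by linarith) (by nlinarith)
  set a := LTI.effSigma Csys ρ σw + σv with ha
  have ha0 : 0 ≤ a := by rw [ha, LTI.effSigma]; positivity
  set q := Csys ^ 3 * (ρ ^ (T - 1) / (1 - ρ)) * σu + Csys ^ 2 / (1 - ρ) * (σw + ε' : ℝ≥0)
    + (σv + ε' : ℝ≥0) with hq
  have hq0 : 0 < q := by
    have : (0 : ℝ) < (σv + ε' : ℝ≥0) := by positivity
    have : 0 ≤ Csys ^ 3 * (ρ ^ (T - 1) / (1 - ρ)) * σu := by positivity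
    positivity
  have hlam0 : 0 < LTI.lambdaScale n p T N Csys ρ σu σw σv ε := by
    rw [LTI.lambdaScale, ← ha]; positivity
  have hlampos : 0 < lam := lt_of_lt_of_le (by positivity) hlam1
  have hqlam : (η + 8) * (σu * q) * √(L / N) * N ≤ lam / 2 * N := by
    have hr1 : √(L / N) ≤ 1 := by
      refine Real.sqrt_le_one.2 ?_
      rw [div_le_one hN']
      linarith
    have hr2 : √(L / N) ≤ √(Real.log ((T : ℝ) * p * n) / N) := by gcongr
    -- Here `ε` absorbs the truncated inputs, and `ε / 2` the enlargement of the noise parameters.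
    have hqa : q ≤ a + 3 / 2 * ε := by
      have : q = Csys ^ 3 * (ρ ^ (T - 1) / (1 - ρ)) * σu + a + κ * ε' := by
        rw [hq, ha, hκ, LTI.effSigma]; push_cast; ring
      rw [this]; linarith
    have : (σu * q) * √(L / N) ≤ 3 * LTI.lambdaScale n p T N Csys ρ σu σw σv ε := by
      calc (σu * q) * √(L / N) ≤ (σu * (a + 3 / 2 * ε)) * √(L / N) := by gcongr
        _ = σu * a * √(L / N) + σu * (3 / 2 * ε) * √(L / N) := by ring
        _ ≤ σu * a * √(Real.log ((T : ℝ) * p * n) / N) + 2 * (3 / 2 * ε) * 1 := by gcongr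
        _ ≤ 3 * LTI.lambdaScale n p T N Csys ρ σu σw σv ε := by
          rw [LTI.lambdaScale, ← ha]
          have : 0 ≤ σu * a * √(Real.log ((T : ℝ) * p * n) / N) := by positivity
          linarith
    refine mul_le_mul_of_nonneg_right ?_ hN'.le
    calc (η + 8) * (σu * q) * √(L / N) = (η + 8) * ((σu * q) * √(L / N)) := by ring
      _ ≤ (η + 8) * (3 * LTI.lambdaScale n p T N Csys ρ σu σw σv ε) := by gcongr
      _ ≤ lam / 2 := by linarith
  have hms := LTI.measurable_source hmeas
  have hsub : ∀ t < T + N - 1, ∀ α, HasSubgaussianMGF (LTI.source u w v t α)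
      (LTI.sourceScale σu (σw + ε') (σv + ε') α ^ 2) μ := by
    intro t ht α
    rcases α with j | j | j
    · exact LTI.hasSubgaussianMGF_of_hasLaw_gaussianReal (hu t ht j)
    · exact LTI.hasSubgaussianMGF_mono (hw t ht j) (by simp only [LTI.sourceScale]; gcongr; simp)
    · exact LTI.hasSubgaussianMGF_mono (hv t ht j) (by simp only [LTI.sourceScale]; gcongr; simp)
  refine LTI.measure_not_good_le hms hind hσu (by positivity) (by positivity) hu hsub hT hN hm hD2
    hLN (fun i => LTI.sum_noiseCoeff_le h1 hρ0 hρ1 hA hB hC hT i _ σu (σw + ε') (σv + ε')) hq0 ?_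
  intro ω hgram hcorr
  rw [Set.mem_ofPred_eq, not_not]
  have hrow : ∀ i, ∑ k, (LTI.markovMatrix A B C D T - Ghat ω) i k ^ 2
      ≤ (√(24 * c₂ + 64 * (η + 8)) * max (LTI.errOne n p T N Csys ρ σu σw σv ε)
        (LTI.errTwo p T N Csys ρ)) ^ 2 := by
    intro i
    refine (LTI.row_error_le h1 hρ0 hρ1 hA hB hC hD hT hN hlampos hσu0
      (δ := (η + 8) * √(L / N)) (by positivity) (hmin ω) i
      (fun k => (hcorr i k).trans hqlam) (fun k l => (hgram k l).trans_eq (by ring))).trans ?_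
    exact LTI.lasso_error_le h1 hρ1 hσu0 hσu2' hσw0 hσv0 hε hc0.le
      ((by positivity : (0 : ℝ) ≤ 6 * (η + 8)).trans hc₂) (by linarith) (by linarith) hlam2
  have hmax : 0 ≤ max (LTI.errOne n p T N Csys ρ σu σw σv ε) (LTI.errTwo p T N Csys ρ) := by
    refine le_max_of_le_right ?_
    rw [LTI.errTwo]
    have : 0 ≤ L / N := by positivity
    positivity
  have : Nonempty (Fin m) := ⟨⟨0, hm⟩⟩
  refine ⟨LTI.twoInfNorm_le (by positivity) hrow, ?_⟩
  refine (LTI.frobNorm_le (by positivity) hrow).trans_eq ?_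
  rw [Fintype.card_fin]
  ring
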